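/- Let $n\ge 2$. The fan graph $F_n$ has vertices $v_2,\dots,v_n,v_\infty$ and edges $v_\infty v_i$ ($2\le i\le n$) and $v_iv_{i+1}$ ($2\le i<n$); labels are ordered $2<3<\dots<n<\infty$. Let $P_n$ be the path $v_\infty,v_2,v_3,\dots,v_n$. The listing $\mathrm{Greedy}(P_n)$ starts with $P_n$. Given the current tree $T$, an edge pivot $T-uv+uw$ (with $uv\in T$ and $uw\in E(F_n)\setminus T$) is valid if the result is a spanning tree of $F_n$ that has not been listed yet. The next tree is obtained by the valid edge pivot that comes first when pivots are ordered by the pivot $u$, then by the other end $v$ of the removed edge, then by the other end $w$ of the added edge, each in increasing order of label; the listing stops when no edge pivot is valid. The listing $\mathrm{LIST}_n$ consists of $P_n$ followed by the trees obtained by successively applying to it the edge moves of $G_n(1,0)$, where the sequences $G_k(s,e)$ of edge moves ($k\ge2$; $s,e\in\{0,1\}$) are defined recursively as follows. Write $[a;b\to c]$ for the move that removes $v_av_b$ and adds $v_av_c$, write $\overline{S}$ for the sequence $S$ reversed with every $[a;b\to c]$ replaced by $[a;c\to b]$, and let $x_k(e)=\infty$ if $e=0$ and $x_k(e)=k+1$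 if $e=1$. - $G_2(s,e)$ is empty if $e=0$ and is $[2;\infty\to3]$ if $e=1$. - $G_3(s,e)$ is $[3;2\to x_3(e)]$ (only if $s=1$), followed by $[2;\infty\to3]$. - For $k\ge4$, $G_k(s,e)$ is the concatenation of: $G_{k-1}(1,0)$ and $[k;k-1\to x_k(e)]$ (both only if $s=1$); $\overline{G_{k-1}(1,0)}$; $[k-1;k-2\to k]$; $G_{k-2}(1,1)$; $[k-2;k-1\to\infty]$ (only if $k>4$); $\overline{G_{k-2}(0,0)}$. Then $\mathrm{LIST}_n=\mathrm{Greedy}(P_n)$, and this listing is a pivot Gray code listing of the spanning trees of $F_n$: it contains every spanning tree of $F_n$ exactly once and nothing else, and each tree in it after the first arises from the one before by removing one edge and adding another edge that shares an endpoint with the removed one. -/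

import Mathlib

namespace FanTrees

/-- Vertex labels: the vertex `v_i` is the label `(i : ℕ∞)`, and `v_∞` is `⊤`, the largest one. -/
abbrev Label := ℕ∞

/-- A set of edges; the trees of the listings are represented by their edge sets. -/
abbrev EdgeSet := Finset (Sym2 Label)

/-- The vertices `v_2, …, v_n, v_∞` of the fan graph `F_n`, in increasing order of label. -/
def vertexList (n : ℕ) : List Label :=
  (List.range' 2 (n - 1)).map (fun i : ℕ => (i : Label)) ++ [⊤]

/-- The edges of `F_n`: all `v_∞ v_i` with `2 ≤ i ≤ n`, and all `v_i v_{i+1}` with `2 ≤ i < n`. -/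
def fanEdges (n : ℕ) : EdgeSet :=
  (Finset.Icc 2 n).image (fun i : ℕ => s((⊤ : Label), (i : Label))) ∪
    (Finset.Ico 2 n).image (fun i : ℕ => s((i : Label), ((i + 1 : ℕ) : Label)))

/-- The graph on the vertices of `F_n` whose edges are those in `E`
(for `E = fanEdges n` it is the fan graph `F_n` itself). -/
def graphOn (n : ℕ) (E : EdgeSet) : SimpleGraph {v : Label | v ∈ vertexList n} :=
  (SimpleGraph.fromEdgeSet (E : Set (Sym2 Label))).induce {v : Label | v ∈ vertexList n}

/-- `T` is (the edge set of) a spanning tree of `F_n`. -/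
def IsSpanningTree (n : ℕ) (T : EdgeSet) : Prop :=
  T ⊆ fanEdges n ∧ (graphOn n T).IsTree

open Classical in
/-- The set of all spanning trees of `F_n`. -/
noncomputable def spanningTrees (n : ℕ) : Finset EdgeSet :=
  (fanEdges n).powerset.filter (IsSpanningTree n)

/-- The edge move with pivot `u` that removes the edge `uv` and adds the edge `uw`,
where `v` is `removed` and `w` is `added`. -/
structure Move where
  pivot : Label
  removed : Label
  added : Label

/-- The effect `T - uv + uw` of an edge move. -/
def Move.apply (m : Move) (T : EdgeSet) : EdgeSet :=
  insert s(m.pivot, m.added) (T.erase s(m.pivot, m.removed))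

/-- The move that undoes `m`. -/
def Move.inv (m : Move) : Move := ⟨m.pivot, m.added, m.removed⟩

/-- The edge `uv` can be removed from `T`, and the edge `uw` of `F_n` can be added to it. -/
def Move.IsPivotMove (n : ℕ) (T : EdgeSet) (m : Move) : Prop :=
  s(m.pivot, m.removed) ∈ T ∧ s(m.pivot, m.added) ∈ fanEdges n ∧ s(m.pivot, m.added) ∉ T

/-- The move is a valid one: its result is a spanning tree of `F_n` that is not in `visited`. -/
def Move.Valid (n : ℕ) (visited : Finset EdgeSet) (T : EdgeSet) (m : Move) : Prop :=
  m.IsPivotMove n T ∧ IsSpanningTree n (m.apply T) ∧ m.apply T ∉ visited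

/-- All triples of vertices of `F_n` as moves, in decreasing order of priority: by the pivot, then
by the other end of the removed edge, then by the other end of the added edge. -/
def movesByPriority (n : ℕ) : List Move :=
  (vertexList n).flatMap fun u =>
    (vertexList n).flatMap fun v =>
      (vertexList n).map fun w => ⟨u, v, w⟩

open Classical in
/-- The valid move of highest priority, if there is a valid move. -/
noncomputable def greedyMove? (n : ℕ) (visited : Finset EdgeSet) (T : EdgeSet) : Option Move :=
  (movesByPriority n).find? fun m => decide (m.Valid n visited T)

theorem greedyMove?_valid {n : ℕ} {visited : Finset EdgeSet} {T : EdgeSet} {m : Move}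
    (h : greedyMove? n visited T = some m) : m.Valid n visited T := by
  simpa using List.find?_some h

theorem card_sdiff_insert_lt {n : ℕ} {visited : Finset EdgeSet} {T : EdgeSet} {m : Move}
    (h : m.Valid n visited T) :
    (spanningTrees n \ insert (m.apply T) visited).card < (spanningTrees n \ visited).card := by
  classical
  have hm : m.apply T ∈ spanningTrees n := by
    simpa [spanningTrees] using ⟨h.2.1.1, h.2.1⟩
  refine Finset.card_lt_card (Finset.ssubset_iff_subset_ne.2 ⟨?_, fun he => ?_⟩)
  · exact Finset.sdiff_subset_sdiff (Finset.Subset.refl _) (Finset.subset_insert _ _)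
  · have : m.apply T ∈ spanningTrees n \ visited := Finset.mem_sdiff.2 ⟨hm, h.2.2⟩
    rw [← he] at this
    exact (Finset.mem_sdiff.1 this).2 (Finset.mem_insert_self _ _)

/-- The trees that the greedy rule lists after the current tree `T`, when the trees in `visited`
have been listed so far. It stops when no move is valid. -/
noncomputable def greedyFrom (n : ℕ) (visited : Finset EdgeSet) (T : EdgeSet) : List EdgeSet :=
  match _h : greedyMove? n visited T with
  | none => []
  | some m => m.apply T :: greedyFrom n (insert (m.apply T) visited) (m.apply T)
termination_by (spanningTrees n \ visited).card
decreasing_by exact card_sdiff_insert_lt (greedyMove?_valid _h)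

/-- The listing `Greedy(T)` of spanning trees of `F_n`. -/
noncomputable def greedy (n : ℕ) (T : EdgeSet) : List EdgeSet :=
  T :: greedyFrom n {T} T

/-- The path `P_n = v_∞, v_2, v_3, …, v_n`. -/
def pathTree (n : ℕ) : EdgeSet :=
  insert s((⊤ : Label), ((2 : ℕ) : Label))
    ((Finset.Ico 2 n).image (fun i : ℕ => s((i : Label), ((i + 1 : ℕ) : Label))))

/-- The operations of a procedure undone, in reverse order. -/
def revMoves (l : List Move) : List Move := (l.map Move.inv).reverse

/-- The sequence of edge moves made by the recursive procedure `Gen(k, s₁, varEdge)`; the tree is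
printed after each of them. The moves of `RevGen(k, s₁, varEdge)` are
`revMoves (gen k s₁ varEdge)`. (There is no call with `k < 2`.) -/
def gen : ℕ → Bool → Bool → List Move
  | 0, _, _ => []
  | 1, _, _ => []
  | 2, _, varEdge => if varEdge then [⟨(2 : ℕ), ⊤, (3 : ℕ)⟩] else []
  | 3, s₁, varEdge =>
      (if s₁ then [⟨(3 : ℕ), (2 : ℕ), if varEdge then (4 : ℕ) else ⊤⟩] else []) ++
        [⟨(2 : ℕ), ⊤, (3 : ℕ)⟩]
  | k + 4, s₁, varEdge =>
      (if s₁ then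
        gen (k + 3) true false ++
          [⟨(k + 4 : ℕ), (k + 3 : ℕ), if varEdge then (k + 5 : ℕ) else ⊤⟩]
      else []) ++
      revMoves (gen (k + 3) true false) ++
      [⟨(k + 3 : ℕ), (k + 2 : ℕ), (k + 4 : ℕ)⟩] ++
      gen (k + 2) true true ++
      (if k + 4 > 4 then [⟨(k + 2 : ℕ), (k + 3 : ℕ), ⊤⟩] else []) ++
      revMoves (gen (k + 2) false false)

/-- The listing `LIST_n`: print `P_n`, then run `Gen(n, 1, 0)`, which prints the current tree after
each move. -/
def genList (n : ℕ) : List EdgeSet :=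
  (gen n true false).scanl (fun T m => m.apply T) (pathTree n)

/-- `T` arises from `S` by removing an edge and adding another one that shares an end with it. -/
def PivotAdj (S T : EdgeSet) : Prop :=
  ∃ m : Move, s(m.pivot, m.removed) ∈ S ∧ s(m.pivot, m.added) ∉ S ∧ T = m.apply S

/-- `L` is a pivot Gray code listing of the spanning trees of `F_n`: each of them occurs exactly
once, nothing else occurs, and consecutive trees differ by an edge pivot. -/
def IsPivotGrayCode (n : ℕ) (L : List EdgeSet) : Prop :=
  L.Nodup ∧ (∀ T, T ∈ L ↔ IsSpanningTree n T) ∧ L.IsChain PivotAdj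

end FanTrees

/-! ### Configurations of spokes and links, and a scan recognising trees -/

namespace FanTrees

/-! Code a subgraph of the fan by its spokes $v_\infty v_i$ and links $v_iv_{i+1}$. It is a spanning
tree exactly when every maximal run of links carries one spoke, which the left-to-right scan `Good`
checks. A pivot at $v_\infty$ has the lowest priority, so only moves with finite pivot have to be
compared along the listing.

The trees on $v_2,\dots,v_n,v_\infty$ split into blocks that are copies of listings of smaller fans.
Those without the spoke of $v_n$ have $v_n$ as a leaf on $v_{n-1}$, a copy of the listing for $n-1$.
Those with this spoke but without the link $v_{n-1}v_n$ form another such copy. If $v_n$ has both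
edges, put $j=n-2$: now $v_jv_{j+1}$ leads to $v_\infty$ just as the spoke of $v_j$ does. The trees
with that spoke are a copy of the second half of the listing for $j$; the others are a copy of the
whole listing for $j$, with the spoke of $v_j$ traded for the link. `tour` runs through these
blocks, some of them backwards.

Hence being greedy is proved for both directions at once, by induction (`FullSpec`, `HalfSpec`).
Inside a block whose small fan ends at $v_j$, a competing move with pivot below $v_j$ pulls back to
the small fan, where the claim is known (`Embeds.greedyRun`); the few competitors at $v_j$ are
treated directly (`LiftsTop`). At a step between blocks (`GreedyRun.glue`), a competitor with
smaller pivot cannot touch the edges that define the part just completed; as that part is exhausted,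
the competitor leads to a listed tree. Competitors with the same pivot are unavailable or give no
tree.

The blocks cover all trees, so the greedy rule stops exactly at the end of the run, and the Gray
code property follows. -/

inductive Edge
  | spoke (i : ℕ)
  | link (i : ℕ)
  deriving DecidableEq

open Edge

/-- The neighbours of `v_i` in the fan: `v_{i-1}`, `v_{i+1}` and `v_∞`. -/
inductive Dir
  | left
  | right
  | hub
  deriving DecidableEq

open Dir

instance : Fintype Dir := ⟨{left, right, hub}, fun d => by cases d <;> simp⟩

def Dir.rank : Dir → ℕ
  | left => 0
  | right => 1
  | hub => 2

abbrev Config := Finset Edge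

def edgesUpTo (k : ℕ) : Config := (Finset.Icc 2 k).image spoke ∪ (Finset.Ico 2 k).image link

@[simp] theorem spoke_mem_edgesUpTo {k i : ℕ} : spoke i ∈ edgesUpTo k ↔ 2 ≤ i ∧ i ≤ k := by
  simp [edgesUpTo]

@[simp] theorem link_mem_edgesUpTo {k i : ℕ} : link i ∈ edgesUpTo k ↔ 2 ≤ i ∧ i < k := by
  simp [edgesUpTo]

def incident (u : ℕ) : Dir → Edge
  | left => link (u - 1)
  | right => link u
  | hub => spoke u

@[simp] theorem incident_left (u : ℕ) : incident u left = link (u - 1) := rfl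
@[simp] theorem incident_right (u : ℕ) : incident u right = link u := rfl
@[simp] theorem incident_hub (u : ℕ) : incident u hub = spoke u := rfl

/-- An edge move with finite pivot, its ends described by their position relative to the pivot. -/
structure Step where
  pivot : ℕ
  removed : Dir
  added : Dir
  deriving DecidableEq

namespace Step

def old (m : Step) : Edge := incident m.pivot m.removed

def new (m : Step) : Edge := incident m.pivot m.added

def apply (m : Step) (T : Config) : Config := insert m.new (T.erase m.old)

def inv (m : Step) : Step := ⟨m.pivot, m.added, m.removed⟩

/-- The first step has higher priority. -/
def Before (m' m : Step) : Prop :=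
  m'.pivot < m.pivot ∨ m'.pivot = m.pivot ∧
    (m'.removed.rank < m.removed.rank ∨
      m'.removed = m.removed ∧ m'.added.rank < m.added.rank)

instance (m' m : Step) : Decidable (m'.Before m) := by unfold Before; infer_instance

def IsPivot (k : ℕ) (T : Config) (m : Step) : Prop :=
  m.old ∈ T ∧ m.new ∈ edgesUpTo k ∧ m.new ∉ T

instance (k : ℕ) (T : Config) (m : Step) : Decidable (m.IsPivot k T) := by
  unfold IsPivot; infer_instance

theorem mem_apply {m : Step} {T : Config} {e : Edge} :
    e ∈ m.apply T ↔ e = m.new ∨ e ≠ m.old ∧ e ∈ T := by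
  simp [apply]

theorem inv_apply_apply {k : ℕ} {m : Step} {T : Config} (h : m.IsPivot k T) :
    m.inv.apply (m.apply T) = T := by
  obtain ⟨h1, -, h3⟩ := h
  ext e
  simp only [mem_apply]
  simp only [inv, new, old] at *
  grind

end Step

/-- `Good T k true` says that in the part of `T` up to `v_k`, every maximal run of links carries
exactly one spoke; `Good T k false` says so except that the run of `v_k` carries none. -/
def Good (T : Config) : ℕ → Bool → Bool
  | 0, _ => false
  | 1, _ => false
  | 2, b => decide (spoke 2 ∈ T) == b
  | k + 3, true =>
      if spoke (k + 3) ∈ T then Good T (k + 2) (!decide (link (k + 2) ∈ T))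
      else decide (link (k + 2) ∈ T) && Good T (k + 2) true
  | k + 3, false => decide (spoke (k + 3) ∉ T) && Good T (k + 2) (!decide (link (k + 2) ∈ T))

theorem good_two {T : Config} {b : Bool} : Good T 2 b = true ↔ (spoke 2 ∈ T ↔ b = true) := by
  cases b <;> simp [Good]

theorem good_succ_true {T : Config} {k : ℕ} (hk : 2 ≤ k) : Good T (k + 1) true = true ↔
    (spoke (k + 1) ∈ T ∧ link k ∈ T ∧ Good T k false = true) ∨
    (spoke (k + 1) ∈ T ∧ link k ∉ T ∧ Good T k true = true) ∨
    (spoke (k + 1) ∉ T ∧ link k ∈ T ∧ Good T k true = true) := by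
  obtain ⟨k, rfl⟩ := Nat.exists_eq_add_of_le' hk
  simp only [Good]
  by_cases h1 : spoke (k + 3) ∈ T <;> by_cases h2 : link (k + 2) ∈ T <;> simp [h1, h2]

theorem good_succ_false {T : Config} {k : ℕ} (hk : 2 ≤ k) : Good T (k + 1) false = true ↔
    spoke (k + 1) ∉ T ∧ ((link k ∈ T ∧ Good T k false = true) ∨
      (link k ∉ T ∧ Good T k true = true)) := by
  obtain ⟨k, rfl⟩ := Nat.exists_eq_add_of_le' hk
  simp only [Good]
  by_cases h1 : spoke (k + 3) ∈ T <;> by_cases h2 : link (k + 2) ∈ T <;> simp [h1, h2]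

theorem spoke_notMem_of_good_false {T : Config} {k : ℕ} (h : Good T k false = true) :
    spoke k ∉ T := by
  match k with
  | 0 => simp [Good] at h
  | 1 => simp [Good] at h
  | 2 => simpa [Good] using h
  | k + 3 => exact ((good_succ_false (by omega)).1 h).1

theorem good_congr {T T' : Config} {k : ℕ} (h : ∀ e ∈ edgesUpTo k, e ∈ T ↔ e ∈ T') (b : Bool) :
    Good T k b = Good T' k b := by
  induction k generalizing b with
  | zero => simp [Good]
  | succ k ih =>
    rcases Nat.lt_or_ge k 2 with hk | hk
    · interval_cases k
      · simp [Good]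
      · simp [Good, h (spoke 2) (by simp)]
    · have hs := h (spoke (k + 1)) (by simp; omega)
      have hl := h (link k) (by simp; omega)
      have ih' := fun b => ih (fun e he => h e (by
        cases e <;> simp at he ⊢ <;> omega)) b
      rw [Bool.eq_iff_iff]
      cases b
      · rw [good_succ_false hk, good_succ_false hk, hs, hl, ih', ih']
      · rw [good_succ_true hk, good_succ_true hk, hs, hl, ih', ih']

/-- The spoke of $v_k$ enters the scan only at its last position, where it decides whether the run
of $v_k$ has been attached to the hub. -/
theorem good_flip {T T' : Config} {k : ℕ} (hk : 2 ≤ k) (hT : spoke k ∈ T) (hT' : spoke k ∉ T')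
    (h : ∀ e ∈ edgesUpTo k, e ≠ spoke k → (e ∈ T ↔ e ∈ T')) :
    Good T' k false = true ↔ Good T k true = true := by
  obtain rfl | hk := hk.eq_or_lt
  · simp [good_two, hT, hT']
  · obtain ⟨k, rfl⟩ := Nat.exists_eq_add_of_le' (show 1 ≤ k by omega)
    have hk : 2 ≤ k := by omega
    have hl := h (link k) (by simp; omega) (by simp)
    have hg := good_congr (T := T) (T' := T') (k := k) (fun e he => h e
      (by cases e <;> simp at he ⊢ <;> omega) (by rintro rfl; simp at he))
    rw [good_succ_false hk, good_succ_true hk, hg, hg, hl]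
    tauto

/-! ### Greedy runs and their reversal, enlargement and concatenation -/

structure IsTree (k : ℕ) (T : Config) : Prop where
  sub : T ⊆ edgesUpTo k
  good : Good T k true = true

instance (k : ℕ) (T : Config) : Decidable (IsTree k T) :=
  decidable_of_iff (T ⊆ edgesUpTo k ∧ Good T k true = true)
    ⟨fun h => ⟨h.1, h.2⟩, fun h => ⟨h.1, h.2⟩⟩

/-- All steps at `T` of higher priority than `m` leading to a tree lead to a tree in `V`. -/
def NoneBefore (k : ℕ) (V : Finset Config) (T : Config) (m : Step) : Prop :=
  ∀ u ∈ Finset.range (m.pivot + 1), ∀ v w : Dir, (⟨u, v, w⟩ : Step).Before m → (⟨u, v, w⟩ : Step).IsPivot k T →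
    IsTree k ((⟨u, v, w⟩ : Step).apply T) → (⟨u, v, w⟩ : Step).apply T ∈ V

theorem noneBefore_iff {k : ℕ} {V : Finset Config} {T : Config} {m : Step} :
    NoneBefore k V T m ↔ ∀ m' : Step, m'.Before m → m'.IsPivot k T → IsTree k (m'.apply T) →
      m'.apply T ∈ V := by
  refine ⟨fun h m' hb => h m'.pivot ?_ m'.removed m'.added hb, fun h u _ v w => h ⟨u, v, w⟩⟩
  rcases hb with hb | hb
  · exact Finset.mem_range.2 (hb.trans (Nat.lt_succ_self _))
  · exact Finset.mem_range.2 (Nat.lt_succ_of_le hb.1.le)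

/-- The steps `ms`, taken from the tree `T` when the trees in `V` have been visited, are those of
the greedy rule. -/
def GreedyRun (k : ℕ) : Finset Config → Config → List Step → Prop
  | _, _, [] => True
  | V, T, m :: ms => (m.IsPivot k T ∧ IsTree k (m.apply T) ∧ m.apply T ∉ V ∧ NoneBefore k V T m) ∧
      GreedyRun k (insert (m.apply T) V) (m.apply T) ms

instance (k : ℕ) (V : Finset Config) (T : Config) (m : Step) : Decidable (NoneBefore k V T m) := by
  unfold NoneBefore; infer_instance

instance decidableGreedyRun (k : ℕ) : (V : Finset Config) → (T : Config) → (ms : List Step) →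
    Decidable (GreedyRun k V T ms)
  | _, _, [] => .isTrue trivial
  | V, T, m :: ms =>
    have := decidableGreedyRun k (insert (m.apply T) V) (m.apply T) ms
    inferInstanceAs (Decidable (_ ∧ _))

def trees (T : Config) (ms : List Step) : List Config := ms.scanl (fun T m => m.apply T) T

def final (T : Config) (ms : List Step) : Config := ms.foldl (fun T m => m.apply T) T

@[simp] theorem trees_nil (T : Config) : trees T [] = [T] := rfl
@[simp] theorem trees_cons (T : Config) (m : Step) (ms : List Step) :
    trees T (m :: ms) = T :: trees (m.apply T) ms := by simp [trees]
@[simp] theorem final_nil (T : Config) : final T [] = T := rfl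
@[simp] theorem final_cons (T : Config) (m : Step) (ms : List Step) :
    final T (m :: ms) = final (m.apply T) ms := rfl
@[simp] theorem final_append (T : Config) (l₁ l₂ : List Step) :
    final T (l₁ ++ l₂) = final (final T l₁) l₂ := by simp [final]

theorem self_mem_trees (T : Config) (ms : List Step) : T ∈ trees T ms := by
  cases ms <;> simp

theorem final_mem_trees (T : Config) (ms : List Step) : final T ms ∈ trees T ms := by
  induction ms generalizing T with
  | nil => simp
  | cons m ms ih => simp [ih]

theorem mem_trees_append_cons {T X : Config} {l₁ l₂ : List Step} {m : Step} :
    X ∈ trees T (l₁ ++ m :: l₂) ↔ X ∈ trees T l₁ ∨ X ∈ trees (m.apply (final T l₁)) l₂ := by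
  induction l₁ generalizing T with
  | nil => simp
  | cons a l ih => simp [ih, or_assoc]

def revSteps (ms : List Step) : List Step := (ms.map Step.inv).reverse

@[simp] theorem revSteps_append (l₁ l₂ : List Step) :
    revSteps (l₁ ++ l₂) = revSteps l₂ ++ revSteps l₁ := by simp [revSteps]
@[simp] theorem revSteps_cons (m : Step) (l : List Step) :
    revSteps (m :: l) = revSteps l ++ [m.inv] := by simp [revSteps]
@[simp] theorem revSteps_revSteps (l : List Step) : revSteps (revSteps l) = l := by
  induction l with
  | nil => rfl
  | cons a l ih => simp [ih]; simp [revSteps, Step.inv]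
@[simp] theorem revSteps_nil : revSteps [] = [] := rfl

theorem mem_revSteps {m : Step} {l : List Step} : m ∈ revSteps l ↔ m.inv ∈ l := by
  simp only [revSteps, List.mem_reverse, List.mem_map]
  constructor
  · rintro ⟨a, ha, rfl⟩; exact ha
  · intro h; exact ⟨_, h, rfl⟩

namespace GreedyRun

theorem isTree {k : ℕ} {V : Finset Config} {T : Config} {ms : List Step} (hT : IsTree k T)
    (h : GreedyRun k V T ms) : ∀ X ∈ trees T ms, IsTree k X := by
  induction ms generalizing V T with
  | nil => simpa using hT
  | cons m ms ih =>
    simp only [trees_cons, List.mem_cons]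
    rintro X (rfl | hX)
    · exact hT
    · exact ih h.1.2.1 h.2 X hX

theorem final_revSteps {k : ℕ} {V : Finset Config} {T : Config} {ms : List Step}
    (h : GreedyRun k V T ms) : final (final T ms) (revSteps ms) = T := by
  induction ms generalizing V T with
  | nil => rfl
  | cons m ms ih =>
    simp [ih h.2, Step.inv_apply_apply h.1.1]

theorem mem_trees_revSteps {k : ℕ} {V : Finset Config} {T : Config} {ms : List Step}
    (h : GreedyRun k V T ms) (X : Config) :
    X ∈ trees (final T ms) (revSteps ms) ↔ X ∈ trees T ms := by
  induction ms generalizing V T with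
  | nil => rfl
  | cons m ms ih =>
    have := final_revSteps h.2
    simp [mem_trees_append_cons, ih h.2, this, Step.inv_apply_apply h.1.1, or_comm]

/-- The condition on competitors is monotone in the visited set, and disjointness keeps the trees of
the run fresh. This is why runs can be specified with only their first tree visited. -/
theorem enlarge {k : ℕ} {V U : Finset Config} {T : Config} {ms : List Step}
    (h : GreedyRun k V T ms) (hU : ∀ X ∈ trees T ms, X ∉ U) : GreedyRun k (V ∪ U) T ms := by
  induction ms generalizing V T with
  | nil => trivial
  | cons m ms ih =>
    simp only [trees_cons, List.mem_cons] at hU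
    refine ⟨⟨h.1.1, h.1.2.1, ?_, ?_⟩, ?_⟩
    · simp only [Finset.mem_union, not_or]
      exact ⟨h.1.2.2.1, hU _ (Or.inr (self_mem_trees _ _))⟩
    · intro u hu v w h1 h2 h3
      exact Finset.mem_union_left _ (h.1.2.2.2 u hu v w h1 h2 h3)
    · rw [← Finset.insert_union]
      exact ih h.2 fun X hX => hU X (Or.inr hX)

/-- `T ∈ V` is required because `trees T l₁` contains `T`, whereas a run inserts only the results of
its steps into the visited set. -/
theorem append {k : ℕ} {V : Finset Config} {T : Config} {l₁ l₂ : List Step} (hT : T ∈ V)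
    (h₁ : GreedyRun k V T l₁)
    (h₂ : GreedyRun k (V ∪ (trees T l₁).toFinset) (final T l₁) l₂) :
    GreedyRun k V T (l₁ ++ l₂) := by
  induction l₁ generalizing V T with
  | nil =>
    have hV : V ∪ {T} = V := Finset.union_eq_left.2 (by simpa using hT)
    simpa [hV] using h₂
  | cons a l ih =>
    refine ⟨h₁.1, ih (Finset.mem_insert_self _ _) h₁.2 ?_⟩
    have hV : insert (a.apply T) V ∪ (trees (a.apply T) l).toFinset =
        V ∪ (trees T (a :: l)).toFinset := by
      have := self_mem_trees (a.apply T) l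
      ext X
      simp only [trees_cons, Finset.mem_union, Finset.mem_insert, List.mem_toFinset,
        List.mem_cons]
      grind
    rw [hV]
    exact h₂

end GreedyRun

/-! ### Copies of a small fan's listing inside a larger fan -/

/-- The trees with at most `v_2, …, v_j` are embedded by `φ` into those on `v_2, …, v_k`, and `φ`
respects the moves with pivot below `j`. -/
structure Embeds (j k : ℕ) (φ : Config → Config) : Prop where
  isTree_iff : ∀ T ⊆ edgesUpTo j, (IsTree k (φ T) ↔ Good T j true = true)
  mem_iff : ∀ T ⊆ edgesUpTo j, ∀ e ∈ edgesUpTo j, e ≠ spoke j → (e ∈ φ T ↔ e ∈ T)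
  comm : ∀ T ⊆ edgesUpTo j, ∀ m : Step, m.old ∈ edgesUpTo j → m.new ∈ edgesUpTo j →
    m.old ≠ spoke j → m.new ≠ spoke j → φ (m.apply T) = m.apply (φ T)
  inj : ∀ T ⊆ edgesUpTo j, ∀ T' ⊆ edgesUpTo j, φ T = φ T' → T = T'

/-- Steps with pivot below $v_j$ are therefore the same in both fans. Since they never touch the
spoke of $v_j$, `Embeds` can leave that spoke free and cover maps that replace it. -/
theorem incident_mem_of_lt {u j k : ℕ} {d : Dir} (hu : u < j) (h : incident u d ∈ edgesUpTo k) :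
    incident u d ∈ edgesUpTo j ∧ incident u d ≠ spoke j := by
  cases d <;> simp at h ⊢ <;> omega

theorem Step.apply_sub {k : ℕ} {T : Config} {m : Step} (hT : T ⊆ edgesUpTo k)
    (hm : m.new ∈ edgesUpTo k) : m.apply T ⊆ edgesUpTo k := by
  intro e he
  rcases Step.mem_apply.1 he with rfl | he
  · exact hm
  · exact hT he.2

/-- The image `m'` of a step `m` with pivot `j` at the image of `T` is a greedy choice among the
steps with pivot `j`. -/
structure LiftsTop (j k : ℕ) (φ : Config → Config) (W : Finset Config) (m' m : Step) (T : Config) :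
    Prop where
  pivot : m'.pivot = j
  isPivot : m'.IsPivot k (φ T)
  apply_eq : m'.apply (φ T) = φ (m.apply T)
  before : ∀ a : Step, a.pivot = j → a.Before m' → a.IsPivot k (φ T) →
    IsTree k (a.apply (φ T)) → a.apply (φ T) ∈ W

/-- A competitor with pivot below $v_j$ comes from a competitor in the small fan, whose result lies
in `V` because the small run is greedy. A competitor at $v_j$ matters only against a step at $v_j$,
and `LiftsTop` sends its result into `W`, the trees visited before the block. -/
theorem Embeds.greedyRun {j k : ℕ} {φ : Config → Config} (hφ : Embeds j k φ)
    {W V : Finset Config} {ψ : Step → Step} {T : Config} {ms : List Step} (hT : IsTree j T)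
    (hle : ∀ m ∈ ms, m.pivot < j ∧ ψ m = m ∨ m.pivot = j ∧ ∀ T, IsTree j T → m.IsPivot j T →
      IsTree j (m.apply T) → LiftsTop j k φ W (ψ m) m T)
    (hV : ∀ X ∈ V, X ⊆ edgesUpTo j) (hW : ∀ X ∈ trees T ms, φ X ∉ W)
    (h : GreedyRun j V T ms) :
    GreedyRun k (V.image φ ∪ W) (φ T) (ms.map ψ) ∧
      trees (φ T) (ms.map ψ) = (trees T ms).map φ ∧ final (φ T) (ms.map ψ) = φ (final T ms) := by
  induction ms generalizing V T with
  | nil => simp [GreedyRun]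
  | cons m ms ih =>
    obtain ⟨⟨hp, ht, hnot, hbef⟩, h⟩ := h
    have hnew : m.apply T ⊆ edgesUpTo j := ht.sub
    have hφT : φ T ⊆ edgesUpTo k := ((hφ.isTree_iff T hT.sub).2 hT.good).sub
    have hφm : IsTree k (φ (m.apply T)) := (hφ.isTree_iff _ hnew).2 ht.good
    have hV' : ∀ X ∈ insert (m.apply T) V, X ⊆ edgesUpTo j := by
      intro X hX
      rcases Finset.mem_insert.1 hX with rfl | hX
      exacts [hnew, hV X hX]
    simp only [trees_cons, List.mem_cons] at hW
    obtain ⟨ih1, ih2, ih3⟩ := ih ht (fun a ha => hle a (List.mem_cons_of_mem _ ha)) hV'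
      (fun X hX => hW X (Or.inr hX)) h
    have hfresh : φ (m.apply T) ∉ V.image φ ∪ W := by
      simp only [Finset.mem_union, Finset.mem_image, not_or, not_exists, not_and]
      refine ⟨fun X hX he => hnot ?_, hW _ (Or.inr (self_mem_trees _ _))⟩
      rwa [← hφ.inj X (hV X hX) _ hnew he]
    have hlow : ∀ a : Step, a.pivot < j → a.Before m → a.IsPivot k (φ T) →
        IsTree k (a.apply (φ T)) → a.apply (φ T) ∈ V.image φ ∪ W := by
      intro a haj hb ha hat
      obtain ⟨ho1, ho2⟩ := incident_mem_of_lt haj (hφT ha.1)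
      obtain ⟨hn1, hn2⟩ := incident_mem_of_lt haj ha.2.1
      have hcomm := hφ.comm T hT.sub a ho1 hn1 ho2 hn2
      have hsub := Step.apply_sub hT.sub hn1
      rw [← hcomm] at hat ⊢
      refine Finset.mem_union_left _ (Finset.mem_image_of_mem _ ?_)
      refine noneBefore_iff.1 hbef a hb ⟨?_, hn1, ?_⟩ ⟨hsub, (hφ.isTree_iff _ hsub).1 hat⟩
      · exact (hφ.mem_iff T hT.sub _ ho1 ho2).1 ha.1
      · exact fun h => ha.2.2 ((hφ.mem_iff T hT.sub _ hn1 hn2).2 h)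
    have key : (ψ m).IsPivot k (φ T) ∧ (ψ m).apply (φ T) = φ (m.apply T) ∧
        NoneBefore k (V.image φ ∪ W) (φ T) (ψ m) := by
      rcases hle m List.mem_cons_self with ⟨hmj, hψ⟩ | ⟨hmj, hl⟩
      · obtain ⟨ho1, ho2⟩ := incident_mem_of_lt hmj (hT.sub hp.1)
        obtain ⟨hn1, hn2⟩ := incident_mem_of_lt hmj hp.2.1
        rw [hψ]
        refine ⟨⟨(hφ.mem_iff T hT.sub _ ho1 ho2).2 hp.1, ?_,
          fun h => hp.2.2 ((hφ.mem_iff T hT.sub _ hn1 hn2).1 h)⟩,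
          (hφ.comm T hT.sub m ho1 hn1 ho2 hn2).symm, ?_⟩
        · refine hφm.sub ?_
          refine (hφ.mem_iff _ hnew _ hn1 hn2).2 ?_
          exact Step.mem_apply.2 (Or.inl rfl)
        · refine noneBefore_iff.2 fun a hb => hlow a ?_ hb
          rcases hb with hb | hb
          · exact hb.trans hmj
          · exact hb.1.trans_lt hmj
      · obtain ⟨l1, l2, l3, l4⟩ := hl T hT hp ht
        refine ⟨l2, l3, noneBefore_iff.2 fun a hb ha hat => ?_⟩
        rcases hb with hb' | hb'
        · exact hlow a (l1 ▸ hb') (Or.inl (by omega)) ha hat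
        · exact Finset.mem_union_right _ (l4 a (hb'.1.trans l1) (Or.inr hb') ha hat)
    refine ⟨⟨⟨key.1, key.2.1 ▸ hφm, key.2.1 ▸ hfresh, key.2.2⟩, ?_⟩, ?_, ?_⟩
    · rw [key.2.1]
      simpa [Finset.image_insert, Finset.insert_union] using ih1
    · simp [key.2.1, ih2]
    · simp [key.2.1, ih3]

/-! ### The sequence of steps, its specification and small cases -/

/-- The moves of `gen k s false`. -/
def tour : ℕ → Bool → List Step
  | 0, _ => []
  | 1, _ => []
  | 2, _ => []
  | 3, s => (if s then [⟨3, left, hub⟩] else []) ++ [⟨2, hub, right⟩]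
  | 4, s => (if s then tour 3 true ++ [⟨4, left, hub⟩] else []) ++
      (revSteps (tour 3 true) ++ ⟨3, left, right⟩ :: [⟨2, hub, right⟩])
  | k + 5, s => (if s then tour (k + 4) true ++ [⟨k + 5, left, hub⟩] else []) ++
      (revSteps (tour (k + 4) true) ++ ⟨k + 4, left, right⟩ ::
      ((tour (k + 2) true ++ ⟨k + 3, left, right⟩ :: tour (k + 3) false) ++
      ⟨k + 3, right, hub⟩ :: revSteps (tour (k + 3) false)))

theorem tour_true {k : ℕ} (hk : 2 ≤ k) :
    tour (k + 1) true = tour k true ++ ⟨k + 1, left, hub⟩ :: tour (k + 1) false := by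
  match k with
  | 2 => simp [tour]
  | 3 => simp [tour]
  | k + 4 => simp [tour]

theorem tour_false (k : ℕ) : tour (k + 5) false =
    revSteps (tour (k + 4) true) ++ ⟨k + 4, left, right⟩ ::
      ((tour (k + 2) true ++ ⟨k + 3, left, right⟩ :: tour (k + 3) false) ++
      ⟨k + 3, right, hub⟩ :: revSteps (tour (k + 3) false)) := by
  simp [tour]

theorem pivot_lt_of_mem_tour (k : ℕ) : (∀ m ∈ tour k false, m.pivot < k) ∧
    ∀ m ∈ tour k true, m.pivot < k ∨ m = ⟨k, left, hub⟩ := by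
  induction k using Nat.strong_induction_on with
  | _ k ih =>
    have h : ∀ m ∈ tour k false, m.pivot < k := by
      match k with
      | 0 => simp [tour]
      | 1 => simp [tour]
      | 2 => simp [tour]
      | 3 => simp [tour]
      | 4 => simp [tour, Step.inv]
      | k + 5 =>
        have h4 : ∀ m ∈ tour (k + 4) true, m.pivot < k + 5 := fun m hm => by
          rcases (ih (k + 4) (by omega)).2 m hm with h | rfl
          · omega
          · exact Nat.lt_succ_self _
        have h2 : ∀ m ∈ tour (k + 2) true, m.pivot < k + 5 := fun m hm => by
          rcases (ih (k + 2) (by omega)).2 m hm with h | rfl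
          · omega
          · exact Nat.lt_of_sub_pos (by simp)
        have h3 : ∀ m ∈ tour (k + 3) false, m.pivot < k + 5 := fun m hm => by
          have := (ih (k + 3) (by omega)).1 m hm
          omega
        intro m hm
        simp only [tour_false, List.mem_append, List.mem_cons, mem_revSteps] at hm
        rcases hm with hm | rfl | (hm | rfl | hm) | rfl | hm
        · have := h4 _ hm
          exact this
        · simp
        · exact h2 _ hm
        · simp
        · exact h3 _ hm
        · simp
        · have := h3 _ hm
          exact this
    refine ⟨h, fun m hm => ?_⟩
    match k with
    | 0 => simp [tour] at hm
    | 1 => simp [tour] at hm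
    | 2 => simp [tour] at hm
    | k + 3 =>
      rw [tour_true (by omega), List.mem_append, List.mem_cons] at hm
      rcases hm with hm | hm | hm
      · rcases (ih (k + 2) (by omega)).2 m hm with h | rfl
        · exact Or.inl (by omega)
        · exact Or.inl (Nat.lt_succ_self _)
      · exact Or.inr hm
      · exact Or.inl (h m hm)

def pathConfig (k : ℕ) : Config := insert (spoke 2) ((Finset.Ico 2 k).image link)

theorem pathConfig_succ {k : ℕ} (hk : 2 ≤ k) :
    pathConfig (k + 1) = insert (link k) (pathConfig k) := by
  ext e
  cases e <;> simp [pathConfig]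
  omega

def endConfig (k : ℕ) : Config := final (pathConfig k) (tour k true)

/-- The tree of the listing from which on all trees have the spoke of `v_k`. -/
def midConfig (k : ℕ) : Config := insert (spoke k) (endConfig (k - 1))

/-- The part of the listing from `midConfig k` on is greedy in both directions. -/
structure HalfSpec (k : ℕ) : Prop where
  forward : GreedyRun k {midConfig k} (midConfig k) (tour k false)
  final_eq : final (midConfig k) (tour k false) = endConfig k
  backward : GreedyRun k {endConfig k} (endConfig k) (revSteps (tour k false))
  mem_trees : ∀ X, X ∈ trees (midConfig k) (tour k false) ↔ IsTree k X ∧ spoke k ∈ X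
  link_mem : link (k - 1) ∈ endConfig k

/-- The listing is greedy in both directions. -/
structure FullSpec (k : ℕ) : Prop where
  forward : GreedyRun k {pathConfig k} (pathConfig k) (tour k true)
  backward : GreedyRun k {endConfig k} (endConfig k) (revSteps (tour k true))
  mem_trees : ∀ X, X ∈ trees (pathConfig k) (tour k true) ↔ IsTree k X

/-- A greedy run never leaves the trees, so the quantifier over all configurations reduces to a
finite one that can be evaluated. -/
theorem mem_trees_of_powerset {k : ℕ} {T : Config} {ms : List Step} {P : Config → Prop}
    (hT : IsTree k T) (h : GreedyRun k {T} T ms)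
    (hX : ∀ X ∈ (edgesUpTo k).powerset, X ∈ trees T ms ↔ IsTree k X ∧ P X) (X : Config) :
    X ∈ trees T ms ↔ IsTree k X ∧ P X :=
  ⟨fun hm => (hX X (Finset.mem_powerset.2 (h.isTree hT X hm).sub)).1 hm,
    fun ht => (hX X (Finset.mem_powerset.2 ht.1.sub)).2 ht⟩

theorem fullSpec_two : FullSpec 2 where
  forward := by decide
  backward := by decide
  mem_trees X := by
    have h := mem_trees_of_powerset (k := 2) (T := pathConfig 2) (ms := tour 2 true)
      (P := fun _ => True) (by decide) (by decide) (by decide) X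
    simpa using h

theorem halfSpec_three : HalfSpec 3 where
  forward := by decide +kernel
  final_eq := by decide +kernel
  backward := by decide +kernel
  mem_trees := mem_trees_of_powerset (by decide +kernel) (by decide +kernel) (by decide +kernel)
  link_mem := by decide +kernel

/-- A separate base case: the path on $v_\infty,v_2$ already has the spoke of $v_2$, so the last two
blocks, of one tree each, come in the opposite order to the general recursion. -/
theorem halfSpec_four : HalfSpec 4 where
  forward := by decide +kernel
  final_eq := by decide +kernel
  backward := by decide +kernel
  mem_trees := mem_trees_of_powerset (by decide +kernel) (by decide +kernel) (by decide +kernel)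
  link_mem := by decide +kernel

/-! ### The four embeddings and the blocks of trees they cover -/

def addLink (j : ℕ) (T : Config) : Config := insert (link j) T

def addSpoke (j : ℕ) (T : Config) : Config := insert (spoke (j + 1)) T

def addBoth (j : ℕ) (T : Config) : Config := insert (link (j + 1)) (insert (spoke (j + 2)) T)

/-- Attach `v_j` to `v_{j+1}` instead of `v_∞`. -/
def swapSpoke (j : ℕ) (T : Config) : Config :=
  if spoke j ∈ T then insert (link j) (T.erase (spoke j)) else T

/-- Once the path $v_\infty v_{j+2}v_{j+1}$ is attached, the link from $v_j$ to $v_{j+1}$ reaches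
the hub as well as the spoke of $v_j$ did. -/
def addBothSwap (j : ℕ) (T : Config) : Config := addBoth j (swapSpoke j T)

theorem notMem_of_sub {T : Config} {j : ℕ} (hT : T ⊆ edgesUpTo j) :
    (∀ i, j ≤ i → link i ∉ T) ∧ ∀ i, j < i → spoke i ∉ T := by
  constructor
  · intro i hi h
    have := hT h
    simp at this
    omega
  · intro i hi h
    have := hT h
    simp at this
    omega

theorem edgesUpTo_mono {j k : ℕ} (h : j ≤ k) : edgesUpTo j ⊆ edgesUpTo k := by
  intro e he
  cases e <;> simp at he ⊢ <;> omega

theorem good_of_inter {T T' : Config} {j : ℕ} (h : ∀ e ∈ edgesUpTo j, e ∈ T ↔ e ∈ T') (b : Bool) :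
    Good T j b = true ↔ Good T' j b = true := by rw [good_congr h]

theorem mem_addBoth {j : ℕ} {T : Config} {e : Edge} :
    e ∈ addBoth j T ↔ e = link (j + 1) ∨ e = spoke (j + 2) ∨ e ∈ T := by
  simp [addBoth]

theorem mem_swapSpoke {j : ℕ} {T : Config} {e : Edge} (hT : link j ∉ T) :
    e ∈ swapSpoke j T ↔ e ≠ spoke j ∧ e ≠ link j ∧ e ∈ T ∨ e = link j ∧ spoke j ∈ T := by
  unfold swapSpoke
  split_ifs <;> simp <;> grind

/-- The run of $v_{j+2}$ has its spoke there, so $v_{j+1}$ must have none; nor may the run of $v_j$,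
if the link from $v_j$ joins it to this one. -/
theorem good_addBoth_iff {j : ℕ} (hj : 2 ≤ j) {X : Config} (h1 : link (j + 1) ∈ X)
    (h2 : spoke (j + 2) ∈ X) : Good X (j + 2) true = true ↔ spoke (j + 1) ∉ X ∧
      (link j ∈ X ∧ Good X j false = true ∨ link j ∉ X ∧ Good X j true = true) := by
  rw [good_succ_true (by omega), good_succ_false hj]
  simp [h1, h2]

theorem embeds_addLink {j : ℕ} (hj : 2 ≤ j) : Embeds j (j + 1) (addLink j) where
  isTree_iff T hT := by
    obtain ⟨hl, hs⟩ := notMem_of_sub hT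
    have hg := good_of_inter (T := addLink j T) (T' := T) (j := j) (fun e he => by
      have : e ≠ link j := by rintro rfl; simp at he
      simp [addLink, this]) true
    have hsub : addLink j T ⊆ edgesUpTo (j + 1) := by
      refine Finset.insert_subset (by simp; omega) (hT.trans (edgesUpTo_mono (by omega)))
    constructor
    · rintro ⟨-, h⟩
      rw [good_succ_true hj, hg] at h
      have := hs (j + 1) (by omega)
      simp [addLink, this] at h
      exact h
    · intro h
      refine ⟨hsub, ?_⟩
      rw [good_succ_true hj, hg]
      have := hs (j + 1) (by omega)
      simp [addLink, this, h]
  mem_iff T hT e he _ := by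
    have : e ≠ link j := by rintro rfl; simp at he
    simp [addLink, this]
  comm T hT m ho hn _ _ := by
    have : m.old ≠ link j := by intro h; rw [h] at ho; simp at ho
    ext e
    simp only [Step.mem_apply, addLink, Finset.mem_insert]
    grind
  inj T hT T' hT' h := by
    have h1 := (notMem_of_sub hT).1 j le_rfl
    have h2 := (notMem_of_sub hT').1 j le_rfl
    ext e
    have := Finset.ext_iff.1 h e
    simp only [addLink, Finset.mem_insert] at this
    grind

theorem embeds_addSpoke {j : ℕ} (hj : 2 ≤ j) : Embeds j (j + 1) (addSpoke j) where
  isTree_iff T hT := by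
    obtain ⟨hl, hs⟩ := notMem_of_sub hT
    have hg := good_of_inter (T := addSpoke j T) (T' := T) (j := j) (fun e he => by
      have : e ≠ spoke (j + 1) := by rintro rfl; simp at he
      simp [addSpoke, this]) true
    have hsub : addSpoke j T ⊆ edgesUpTo (j + 1) := by
      refine Finset.insert_subset (by simp; omega) (hT.trans (edgesUpTo_mono (by omega)))
    have hl := hl j le_rfl
    constructor
    · rintro ⟨-, h⟩
      rw [good_succ_true hj, hg] at h
      simp [addSpoke, hl] at h
      exact h
    · intro h
      refine ⟨hsub, ?_⟩
      rw [good_succ_true hj, hg]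
      simp [addSpoke, hl, h]
  mem_iff T hT e he _ := by
    have : e ≠ spoke (j + 1) := by rintro rfl; simp at he
    simp [addSpoke, this]
  comm T hT m ho hn _ _ := by
    have : m.old ≠ spoke (j + 1) := by intro h; rw [h] at ho; simp at ho
    ext e
    simp only [Step.mem_apply, addSpoke, Finset.mem_insert]
    grind
  inj T hT T' hT' h := by
    have h1 := (notMem_of_sub hT).2 (j + 1) (Nat.lt_succ_self _)
    have h2 := (notMem_of_sub hT').2 (j + 1) (Nat.lt_succ_self _)
    ext e
    have := Finset.ext_iff.1 h e
    simp only [addSpoke, Finset.mem_insert] at this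
    grind

theorem embeds_addBoth {j : ℕ} (hj : 2 ≤ j) : Embeds j (j + 2) (addBoth j) where
  isTree_iff T hT := by
    obtain ⟨hl, hs⟩ := notMem_of_sub hT
    have hg := good_of_inter (T := addBoth j T) (T' := T) (j := j) (fun e he => by
      have h1 : e ≠ spoke (j + 2) := by rintro rfl; simp at he
      have h2 : e ≠ link (j + 1) := by rintro rfl; simp at he
      simp [mem_addBoth, h1, h2]) true
    have hsub : addBoth j T ⊆ edgesUpTo (j + 2) := by
      refine Finset.insert_subset (by simp; omega) (Finset.insert_subset (by simp)
        (hT.trans (edgesUpTo_mono (by omega))))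
    have hl := hl j le_rfl
    have hs := hs (j + 1) (Nat.lt_succ_self _)
    have key : Good (addBoth j T) (j + 2) true = true ↔ Good T j true = true := by
      rw [good_addBoth_iff hj (by simp [mem_addBoth]) (by simp [mem_addBoth]), hg]
      simp [mem_addBoth, hl, hs]
    exact ⟨fun h => key.1 h.good, fun h => ⟨hsub, key.2 h⟩⟩
  mem_iff T hT e he _ := by
    have h1 : e ≠ spoke (j + 2) := by rintro rfl; simp at he
    have h2 : e ≠ link (j + 1) := by rintro rfl; simp at he
    simp [mem_addBoth, h1, h2]
  comm T hT m ho hn _ _ := by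
    have h1 : m.old ≠ spoke (j + 2) := by intro h; rw [h] at ho; simp at ho
    have h2 : m.old ≠ link (j + 1) := by intro h; rw [h] at ho; simp at ho
    ext e
    simp only [Step.mem_apply, mem_addBoth]
    grind
  inj T hT T' hT' h := by
    obtain ⟨hl, hs⟩ := notMem_of_sub hT
    obtain ⟨hl', hs'⟩ := notMem_of_sub hT'
    have h1 := hl (j + 1) (by omega)
    have h2 := hs (j + 2) (by omega)
    have h3 := hl' (j + 1) (by omega)
    have h4 := hs' (j + 2) (by omega)
    ext e
    have := Finset.ext_iff.1 h e
    simp only [mem_addBoth] at this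
    grind

theorem embeds_addBothSwap {j : ℕ} (hj : 2 ≤ j) : Embeds j (j + 2) (addBothSwap j) where
  isTree_iff T hT := by
    obtain ⟨hl, hs⟩ := notMem_of_sub hT
    have hl := hl j le_rfl
    have hmem : ∀ e, e ∈ addBothSwap j T ↔ e = link (j + 1) ∨ e = spoke (j + 2) ∨
      (e ≠ spoke j ∧ e ≠ link j ∧ e ∈ T ∨ e = link j ∧ spoke j ∈ T) := fun e => by
        rw [addBothSwap, mem_addBoth, mem_swapSpoke hl]
    have hsub : addBothSwap j T ⊆ edgesUpTo (j + 2) := by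
      intro e he
      rcases (hmem e).1 he with rfl | rfl | h | h
      · simp; omega
      · simp
      · exact edgesUpTo_mono (by omega) (hT h.2.2)
      · rw [h.1]; simp; omega
    have hs := hs (j + 1) (Nat.lt_succ_self _)
    have key : Good (addBothSwap j T) (j + 2) true = true ↔ Good T j true = true := by
      rw [good_addBoth_iff hj (by simp [hmem]) (by simp [hmem])]
      have hagree : ∀ e ∈ edgesUpTo j, e ≠ spoke j → (e ∈ T ↔ e ∈ addBothSwap j T) := by
        intro e he hne
        have h1 : e ≠ spoke (j + 2) := by rintro rfl; simp at he
        have h2 : e ≠ link (j + 1) := by rintro rfl; simp at he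
        have h3 : e ≠ link j := by rintro rfl; simp at he
        simp [hmem, h1, h2, h3, hne]
      by_cases hsp : spoke j ∈ T
      -- Trading the spoke for the link turns the scan at $v_j$ to `false`, just the state required
      -- when `link j` is present.
      · rw [good_flip hj hsp (by simp [hmem]) hagree]
        simp [hmem, hs, hsp]
      · have hg := good_of_inter (T := addBothSwap j T) (T' := T) (j := j) (fun e he => by
          by_cases hne : e = spoke j
          · subst hne; simp [hmem, hsp]
          · exact (hagree e he hne).symm) true
        rw [hg]
        simp [hmem, hs, hsp]
    exact ⟨fun h => key.1 h.good, fun h => ⟨hsub, key.2 h⟩⟩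
  mem_iff T hT e he hne := by
    have hl := (notMem_of_sub hT).1 j le_rfl
    have h1 : e ≠ spoke (j + 2) := by rintro rfl; simp at he
    have h2 : e ≠ link (j + 1) := by rintro rfl; simp at he
    have h3 : e ≠ link j := by rintro rfl; simp at he
    simp [addBothSwap, mem_addBoth, mem_swapSpoke hl, h1, h2, h3, hne]
  comm T hT m ho hn ho' hn' := by
    have hl := (notMem_of_sub hT).1 j le_rfl
    have hl' := (notMem_of_sub (Step.apply_sub hT hn)).1 j le_rfl
    have h1 : m.old ≠ spoke (j + 2) := by intro h; rw [h] at ho; simp at ho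
    have h2 : m.old ≠ link (j + 1) := by intro h; rw [h] at ho; simp at ho
    have h3 : m.old ≠ link j := by intro h; rw [h] at ho; simp at ho
    have h4 : m.new ≠ link j := by intro h; rw [h] at hn; simp at hn
    ext e
    simp only [addBothSwap, Step.mem_apply, mem_addBoth, mem_swapSpoke hl, mem_swapSpoke hl']
    grind
  inj T hT T' hT' h := by
    obtain ⟨hl, hs⟩ := notMem_of_sub hT
    obtain ⟨hl', hs'⟩ := notMem_of_sub hT'
    have h1 := hl (j + 1) (by omega)
    have h2 := hs (j + 2) (by omega)
    have h3 := hl' (j + 1) (by omega)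
    have h4 := hs' (j + 2) (by omega)
    have h5 := hl j le_rfl
    have h6 := hl' j le_rfl
    have hj := Finset.ext_iff.1 h (link j)
    ext e
    have := Finset.ext_iff.1 h e
    simp only [addBothSwap, mem_addBoth, mem_swapSpoke h5, mem_swapSpoke h6] at this hj
    grind

theorem isTree_addLink {j : ℕ} (hj : 2 ≤ j) {X : Config} :
    (∃ Y, IsTree j Y ∧ addLink j Y = X) ↔ IsTree (j + 1) X ∧ spoke (j + 1) ∉ X := by
  constructor
  · rintro ⟨Y, hY, rfl⟩
    refine ⟨((embeds_addLink hj).isTree_iff Y hY.sub).2 hY.good, ?_⟩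
    simp [addLink, (notMem_of_sub hY.sub).2]
  · rintro ⟨hX, hs⟩
    have hl : link j ∈ X := by
      have := (good_succ_true hj).1 hX.good
      tauto
    have hsub : X.erase (link j) ⊆ edgesUpTo j := by
      intro e he
      have h1 := hX.sub (Finset.mem_of_mem_erase he)
      have h2 := Finset.ne_of_mem_erase he
      have h3 : e ≠ spoke (j + 1) := by
        rintro rfl; exact hs (Finset.mem_of_mem_erase he)
      cases e <;> simp at h1 h2 h3 ⊢ <;> omega
    have heq : addLink j (X.erase (link j)) = X := Finset.insert_erase hl
    refine ⟨_, ⟨hsub, ?_⟩, heq⟩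
    rw [← (embeds_addLink hj).isTree_iff _ hsub, heq]
    exact hX

theorem isTree_addSpoke {j : ℕ} (hj : 2 ≤ j) {X : Config} :
    (∃ Y, IsTree j Y ∧ addSpoke j Y = X) ↔
      IsTree (j + 1) X ∧ spoke (j + 1) ∈ X ∧ link j ∉ X := by
  constructor
  · rintro ⟨Y, hY, rfl⟩
    refine ⟨((embeds_addSpoke hj).isTree_iff Y hY.sub).2 hY.good, ?_⟩
    simp [addSpoke, (notMem_of_sub hY.sub).1]
  · rintro ⟨hX, hs, hl⟩
    have hsub : X.erase (spoke (j + 1)) ⊆ edgesUpTo j := by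
      intro e he
      have h1 := hX.sub (Finset.mem_of_mem_erase he)
      have h2 := Finset.ne_of_mem_erase he
      have h3 : e ≠ link j := by
        rintro rfl; exact hl (Finset.mem_of_mem_erase he)
      cases e <;> simp at h1 h2 h3 ⊢ <;> omega
    have heq : addSpoke j (X.erase (spoke (j + 1))) = X := Finset.insert_erase hs
    refine ⟨_, ⟨hsub, ?_⟩, heq⟩
    rw [← (embeds_addSpoke hj).isTree_iff _ hsub, heq]
    exact hX

/-- A tree in which `v_{j+2}` has both its edges, and the spoke of `v_j` is present. -/
theorem isTree_addBoth {j : ℕ} (hj : 2 ≤ j) {X : Config} :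
    (∃ Y, (IsTree j Y ∧ spoke j ∈ Y) ∧ addBoth j Y = X) ↔
      IsTree (j + 2) X ∧ spoke (j + 2) ∈ X ∧ link (j + 1) ∈ X ∧ spoke j ∈ X := by
  constructor
  · rintro ⟨Y, ⟨hY, hs⟩, rfl⟩
    refine ⟨((embeds_addBoth hj).isTree_iff Y hY.sub).2 hY.good, ?_⟩
    simp [mem_addBoth, hs]
  · rintro ⟨hX, hs, hl, hsj⟩
    have hg := (good_addBoth_iff hj hl hs).1 hX.good
    have hlj : link j ∉ X := fun h => by
      rcases hg.2 with h' | h'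
      · exact spoke_notMem_of_good_false h'.2 hsj
      · exact h'.1 h
    have hsub : (X.erase (spoke (j + 2))).erase (link (j + 1)) ⊆ edgesUpTo j := by
      intro e he
      simp only [Finset.mem_erase] at he
      obtain ⟨h2, h3, he⟩ := he
      have h1 := hX.sub he
      have h4 : e ≠ link j := by rintro rfl; exact hlj he
      have h5 : e ≠ spoke (j + 1) := by rintro rfl; exact hg.1 he
      cases e <;> simp at h1 h2 h3 h4 h5 ⊢ <;> omega
    have heq : addBoth j ((X.erase (spoke (j + 2))).erase (link (j + 1))) = X := by
      ext e
      simp only [mem_addBoth, Finset.mem_erase]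
      grind
    refine ⟨_, ⟨⟨hsub, ?_⟩, by simp [hsj]⟩, heq⟩
    rw [← (embeds_addBoth hj).isTree_iff _ hsub, heq]
    exact hX

/-- The preimage trades `link j` back for the spoke of $v_j$. A tree with neither of these edges
also belongs to this block; `swapSpoke` fixes its restriction to the small fan. -/
theorem isTree_addBothSwap {j : ℕ} (hj : 2 ≤ j) {X : Config} :
    (∃ Y, IsTree j Y ∧ addBothSwap j Y = X) ↔
      IsTree (j + 2) X ∧ spoke (j + 2) ∈ X ∧ link (j + 1) ∈ X ∧ spoke j ∉ X := by
  constructor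
  · rintro ⟨Y, hY, rfl⟩
    refine ⟨((embeds_addBothSwap hj).isTree_iff Y hY.sub).2 hY.good, ?_⟩
    simp [addBothSwap, mem_addBoth, mem_swapSpoke ((notMem_of_sub hY.sub).1 j le_rfl)]
  · rintro ⟨hX, hs, hl, hsj⟩
    have hg := (good_addBoth_iff hj hl hs).1 hX.good
    obtain ⟨Y, hY⟩ : ∃ Y : Config, ∀ e, e ∈ Y ↔ e ≠ spoke (j + 2) ∧ e ≠ link (j + 1) ∧
        (e ∈ X ∧ e ≠ link j ∨ e = spoke j ∧ link j ∈ X) := by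
      refine ⟨((if link j ∈ X then insert (spoke j) (X.erase (link j)) else X).erase
        (link (j + 1))).erase (spoke (j + 2)), fun e => ?_⟩
      split_ifs <;> simp <;> grind
    have hsub : Y ⊆ edgesUpTo j := by
      intro e he
      obtain ⟨h2, h3, he⟩ := (hY e).1 he
      rcases he with ⟨he, h4⟩ | ⟨rfl, -⟩
      · have h1 := hX.sub he
        have h5 : e ≠ spoke (j + 1) := by rintro rfl; exact hg.1 he
        cases e <;> simp at h1 h2 h3 h4 h5 ⊢ <;> omega
      · simpa using hj
    have heq : addBothSwap j Y = X := by
      ext e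
      rw [addBothSwap, mem_addBoth, mem_swapSpoke ((notMem_of_sub hsub).1 j le_rfl), hY, hY]
      grind
    refine ⟨Y, ⟨hsub, ?_⟩, heq⟩
    rw [← (embeds_addBothSwap hj).isTree_iff _ hsub, heq]
    exact hX

/-! ### Gluing blocks, and transporting whole listings -/

/-- With `link_mem_apply`, this keeps competitors with smaller pivot inside the part just completed
at a connecting step. -/
theorem Step.spoke_mem_apply {m : Step} {T : Config} {i : ℕ} (h : m.pivot < i) :
    spoke i ∈ m.apply T ↔ spoke i ∈ T := by
  have h1 : ∀ d, spoke i ≠ incident m.pivot d := fun d => by cases d <;> simp; omega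
  simp [Step.mem_apply, old, new, h1]

theorem Step.link_mem_apply {m : Step} {T : Config} {i : ℕ} (h : m.pivot < i) :
    link i ∈ m.apply T ↔ link i ∈ T := by
  have h1 : ∀ d, link i ≠ incident m.pivot d := fun d => by cases d <;> simp <;> omega
  simp [Step.mem_apply, old, new, h1]

theorem GreedyRun.glue {k : ℕ} {T A B : Config} {l₁ l₂ : List Step} {m : Step}
    (h₁ : GreedyRun k {T} T l₁) (hA : final T l₁ = A) (hB : m.apply A = B)
    (hm : m.IsPivot k A) (ht : IsTree k B) (hfresh : B ∉ trees T l₁)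
    (hbef : ∀ a : Step, a.Before m → a.IsPivot k A → IsTree k (a.apply A) →
      a.apply A ∈ trees T l₁)
    (h₂ : GreedyRun k ({B} ∪ (trees T l₁).toFinset) B l₂) :
    GreedyRun k {T} T (l₁ ++ m :: l₂) := by
  have hU : {T} ∪ (trees T l₁).toFinset = (trees T l₁).toFinset :=
    Finset.union_eq_right.2 (by simpa using self_mem_trees T l₁)
  refine h₁.append (Finset.mem_singleton_self _) ?_
  rw [hA, hU]
  refine ⟨⟨hm, hB ▸ ht, ?_, noneBefore_iff.2 fun a h1 h2 h3 => ?_⟩, ?_⟩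
  · rw [hB]
    simpa using hfresh
  · simpa using hbef a h1 h2 h3
  · rw [hB]
    exact h₂

/-- A greedy run embedded in a larger fan, with the set `W` visited in advance. -/
theorem Embeds.segment {j k : ℕ} {φ : Config → Config} (hφ : Embeds j k φ)
    {W : Finset Config} {ψ : Step → Step} {T : Config} {ms : List Step} (hT : IsTree j T)
    (hle : ∀ m ∈ ms, m.pivot < j ∧ ψ m = m ∨ m.pivot = j ∧ ∀ T, IsTree j T → m.IsPivot j T →
      IsTree j (m.apply T) → LiftsTop j k φ W (ψ m) m T)
    (hW : ∀ X ∈ trees T ms, φ X ∉ W) (h : GreedyRun j {T} T ms) :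
    GreedyRun k ({φ T} ∪ W) (φ T) (ms.map ψ) ∧
      (∀ X, X ∈ trees (φ T) (ms.map ψ) ↔ ∃ Y, Y ∈ trees T ms ∧ φ Y = X) ∧
      final (φ T) (ms.map ψ) = φ (final T ms) := by
  obtain ⟨h1, h2, h3⟩ := hφ.greedyRun hT hle
    (fun X hX => by rw [Finset.mem_singleton.1 hX]; exact hT.sub) hW h
  refine ⟨by simpa using h1, fun X => ?_, h3⟩
  rw [h2, List.mem_map]

theorem FullSpec.isTree_path {k : ℕ} (h : FullSpec k) : IsTree k (pathConfig k) :=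
  (h.mem_trees _).1 (self_mem_trees _ _)

theorem FullSpec.isTree_end {k : ℕ} (h : FullSpec k) : IsTree k (endConfig k) :=
  (h.mem_trees _).1 (final_mem_trees _ _)

theorem FullSpec.final_revSteps {k : ℕ} (h : FullSpec k) :
    final (endConfig k) (revSteps (tour k true)) = pathConfig k := h.forward.final_revSteps

theorem FullSpec.mem_trees_revSteps {k : ℕ} (h : FullSpec k) (X : Config) :
    X ∈ trees (endConfig k) (revSteps (tour k true)) ↔ IsTree k X := by
  rw [← h.mem_trees]
  exact h.forward.mem_trees_revSteps X

theorem HalfSpec.mid {k : ℕ} (h : HalfSpec k) : IsTree k (midConfig k) ∧ spoke k ∈ midConfig k :=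
  (h.mem_trees _).1 (self_mem_trees _ _)

theorem HalfSpec.end {k : ℕ} (h : HalfSpec k) : IsTree k (endConfig k) ∧ spoke k ∈ endConfig k := by
  rw [← h.final_eq]
  exact (h.mem_trees _).1 (final_mem_trees _ _)

theorem HalfSpec.final_revSteps {k : ℕ} (h : HalfSpec k) :
    final (endConfig k) (revSteps (tour k false)) = midConfig k := by
  rw [← h.final_eq]
  exact h.forward.final_revSteps

theorem HalfSpec.mem_trees_revSteps {k : ℕ} (h : HalfSpec k) (X : Config) :
    X ∈ trees (endConfig k) (revSteps (tour k false)) ↔ IsTree k X ∧ spoke k ∈ X := by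
  rw [← h.mem_trees, ← h.final_eq]
  exact h.forward.mem_trees_revSteps X

/-- The segment lemma for runs all of whose pivots are `v_j` only in steps to or from the hub. -/
theorem Embeds.segment_full {j k : ℕ} {φ : Config → Config} (hφ : Embeds j k φ)
    {W : Finset Config} (hF : FullSpec j)
    (htop : ∀ T, IsTree j T → (⟨j, left, hub⟩ : Step).IsPivot j T →
      IsTree j ((⟨j, left, hub⟩ : Step).apply T) → LiftsTop j k φ W ⟨j, left, hub⟩ ⟨j, left, hub⟩ T)
    (hW : ∀ X, IsTree j X → φ X ∉ W) :
    GreedyRun k ({φ (pathConfig j)} ∪ W) (φ (pathConfig j)) (tour j true) ∧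
      (∀ X, X ∈ trees (φ (pathConfig j)) (tour j true) ↔ ∃ Y, IsTree j Y ∧ φ Y = X) ∧
      final (φ (pathConfig j)) (tour j true) = φ (endConfig j) := by
  have := hφ.segment (ψ := id) (W := W) hF.isTree_path (fun m hm => ?_)
    (fun X hX => hW X ((hF.mem_trees X).1 hX)) hF.forward
  · simp only [List.map_id, hF.mem_trees] at this
    exact this
  · rcases (pivot_lt_of_mem_tour j).2 m hm with h | rfl
    · exact Or.inl ⟨h, rfl⟩
    · exact Or.inr ⟨rfl, htop⟩

theorem Embeds.segment_full_rev {j k : ℕ} {φ : Config → Config} (hφ : Embeds j k φ)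
    {W : Finset Config} (hF : FullSpec j)
    (htop : ∀ T, IsTree j T → (⟨j, hub, left⟩ : Step).IsPivot j T →
      IsTree j ((⟨j, hub, left⟩ : Step).apply T) → LiftsTop j k φ W ⟨j, hub, left⟩ ⟨j, hub, left⟩ T)
    (hW : ∀ X, IsTree j X → φ X ∉ W) :
    GreedyRun k ({φ (endConfig j)} ∪ W) (φ (endConfig j)) (revSteps (tour j true)) ∧
      (∀ X, X ∈ trees (φ (endConfig j)) (revSteps (tour j true)) ↔ ∃ Y, IsTree j Y ∧ φ Y = X) ∧
      final (φ (endConfig j)) (revSteps (tour j true)) = φ (pathConfig j) := by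
  have := hφ.segment (ψ := id) (W := W) hF.isTree_end (fun m hm => ?_)
    (fun X hX => hW X ((hF.mem_trees_revSteps X).1 hX)) hF.backward
  · simpa only [List.map_id, hF.mem_trees_revSteps, hF.final_revSteps] using this
  · rw [mem_revSteps] at hm
    rcases (pivot_lt_of_mem_tour j).2 _ hm with h | h
    · exact Or.inl ⟨h, rfl⟩
    · obtain ⟨p, r, a⟩ := m
      simp only [Step.inv, Step.mk.injEq] at h
      obtain ⟨rfl, rfl, rfl⟩ := h
      exact Or.inr ⟨rfl, htop⟩

theorem Embeds.segment_half {j k : ℕ} {φ : Config → Config} (hφ : Embeds j k φ)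
    {W : Finset Config} (hH : HalfSpec j) (hW : ∀ X, IsTree j X → spoke j ∈ X → φ X ∉ W) :
    GreedyRun k ({φ (midConfig j)} ∪ W) (φ (midConfig j)) (tour j false) ∧
      (∀ X, X ∈ trees (φ (midConfig j)) (tour j false) ↔
        ∃ Y, (IsTree j Y ∧ spoke j ∈ Y) ∧ φ Y = X) ∧
      final (φ (midConfig j)) (tour j false) = φ (endConfig j) := by
  have := hφ.segment (ψ := id) (W := W) hH.mid.1
    (fun m hm => Or.inl ⟨(pivot_lt_of_mem_tour j).1 m hm, rfl⟩)
    (fun X hX => hW X ((hH.mem_trees X).1 hX).1 ((hH.mem_trees X).1 hX).2) hH.forward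
  simpa only [List.map_id, hH.mem_trees, hH.final_eq] using this

theorem Embeds.segment_half_rev {j k : ℕ} {φ : Config → Config} (hφ : Embeds j k φ)
    {W : Finset Config} (hH : HalfSpec j) (hW : ∀ X, IsTree j X → spoke j ∈ X → φ X ∉ W) :
    GreedyRun k ({φ (endConfig j)} ∪ W) (φ (endConfig j)) (revSteps (tour j false)) ∧
      (∀ X, X ∈ trees (φ (endConfig j)) (revSteps (tour j false)) ↔
        ∃ Y, (IsTree j Y ∧ spoke j ∈ Y) ∧ φ Y = X) ∧
      final (φ (endConfig j)) (revSteps (tour j false)) = φ (midConfig j) := by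
  have := hφ.segment (ψ := id) (W := W) hH.end.1
    (fun m hm => Or.inl ⟨(pivot_lt_of_mem_tour j).1 m.inv (mem_revSteps.1 hm), rfl⟩)
    (fun X hX => hW X ((hH.mem_trees_revSteps X).1 hX).1 ((hH.mem_trees_revSteps X).1 hX).2)
    hH.backward
  simpa only [List.map_id, hH.mem_trees_revSteps, hH.final_revSteps] using this

/-! ### Competitors with the same pivot -/

section Before

variable {a : Step} {j k : ℕ} {A : Config}

/-- Only left to left precedes left to right at the same pivot, and it would add an edge that is
already present. -/
theorem Step.Before.of_left_right (h : a.Before ⟨j, left, right⟩) (hj : a.pivot = j) :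
    ¬ a.IsPivot k A := by
  obtain ⟨p, r, w⟩ := a
  subst hj
  rintro ⟨h1, -, h3⟩
  cases r <;> cases w <;> simp_all [Step.Before, Dir.rank, old, new]

theorem Step.Before.of_left_hub (h : a.Before ⟨j, left, hub⟩) (hj : a.pivot = j)
    (ha : a.IsPivot k A) : a = ⟨j, left, right⟩ := by
  obtain ⟨p, r, w⟩ := a
  subst hj
  obtain ⟨h1, -, h3⟩ := ha
  cases r <;> cases w <;> simp_all [Step.Before, Dir.rank, old, new]

theorem Step.Before.of_right_left (h : a.Before ⟨j, right, left⟩) (hj : a.pivot = j)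
    (hA : link (j - 1) ∉ A) : ¬ a.IsPivot k A := by
  obtain ⟨p, r, w⟩ := a
  subst hj
  rintro ⟨h1, -, h3⟩
  cases r <;> cases w <;> simp_all [Step.Before, Dir.rank, old]

theorem Step.Before.of_hub_left (h : a.Before ⟨j, hub, left⟩) (hj : a.pivot = j)
    (hA : link (j - 1) ∉ A) (ha : a.IsPivot k A) : a.removed = right := by
  obtain ⟨p, r, w⟩ := a
  subst hj
  obtain ⟨h1, -, h3⟩ := ha
  cases r <;> cases w <;> simp_all [Step.Before, Dir.rank, old, new]

/-- The presence of `link (j - 1)` excludes right to left, which would otherwise take precedence. -/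
theorem Step.Before.of_right_hub (h : a.Before ⟨j, right, hub⟩) (hj : a.pivot = j)
    (hA : link (j - 1) ∈ A) (hA' : link j ∈ A) (ha : a.IsPivot k A) : a = ⟨j, left, hub⟩ := by
  obtain ⟨p, r, w⟩ := a
  subst hj
  obtain ⟨h1, -, h3⟩ := ha
  cases r <;> cases w <;> simp_all [Step.Before, Dir.rank, old, new]

theorem Step.Before.of_hub_right (h : a.Before ⟨j, hub, right⟩) (hj : a.pivot = j)
    (hA : link (j - 1) ∈ A) (hA' : link j ∉ A) (hA'' : spoke j ∈ A) (ha : a.IsPivot k A) :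
    a = ⟨j, left, right⟩ := by
  obtain ⟨p, r, w⟩ := a
  subst hj
  obtain ⟨h1, -, h3⟩ := ha
  cases r <;> cases w <;> simp_all [Step.Before, Dir.rank, old, new]

end Before

/-! ### From the half listing to the full listing -/

theorem liftsTop_insert {j k : ℕ} {x : Edge} {W : Finset Config} {m : Step} {T : Config}
    (hx : x ∉ edgesUpTo j) (hjk : j ≤ k) (hT : T ⊆ edgesUpTo j) (hm : m.pivot = j)
    (hp : m.IsPivot j T)
    (hb : ∀ a : Step, a.pivot = j → a.Before m → a.IsPivot k (insert x T) →
      IsTree k (a.apply (insert x T)) → a.apply (insert x T) ∈ W) :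
    LiftsTop j k (insert x) W m m T := by
  obtain ⟨h1, h2, h3⟩ := hp
  have hn : m.new ≠ x := fun h => hx (h ▸ h2)
  have ho : m.old ≠ x := fun h => hx (h ▸ hT h1)
  refine ⟨hm, ⟨Finset.mem_insert_of_mem h1, edgesUpTo_mono hjk h2, by simp [hn, h3]⟩, ?_, hb⟩
  ext e
  simp only [Step.mem_apply, Finset.mem_insert]
  grind

theorem IsTree.spoke_or_link {j : ℕ} (hj : 2 ≤ j) {X : Config} (h : IsTree (j + 1) X) :
    spoke (j + 1) ∈ X ∨ link j ∈ X := by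
  have := (good_succ_true hj).1 h.good
  tauto

theorem midConfig_eq (j : ℕ) : midConfig (j + 1) = addSpoke j (endConfig j) := rfl

theorem addLink_segment {j : ℕ} (hj : 2 ≤ j) (hF : FullSpec j) :
    GreedyRun (j + 1) {addLink j (pathConfig j)} (addLink j (pathConfig j)) (tour j true) ∧
      (∀ X, X ∈ trees (addLink j (pathConfig j)) (tour j true) ↔
        IsTree (j + 1) X ∧ spoke (j + 1) ∉ X) ∧
      final (addLink j (pathConfig j)) (tour j true) = addLink j (endConfig j) := by
  have := (embeds_addLink hj).segment_full (W := ∅) hF (fun T hT hp ht =>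
    liftsTop_insert (by simp) (Nat.le_succ j) hT.sub rfl hp fun a h1 h2 h3 h4 => by
      -- The only possible competitor adds `link j`, which `addLink` has already inserted.
      obtain rfl := h2.of_left_hub h1 h3
      exact absurd (Finset.mem_insert_self _ _) h3.2.2) (by simp)
  simpa only [isTree_addLink hj, Finset.union_empty] using this

theorem apply_addLink {j : ℕ} {T : Config} (hT : T ⊆ edgesUpTo j) :
    (⟨j + 1, left, hub⟩ : Step).apply (addLink j T) = addSpoke j T := by
  have := (notMem_of_sub hT).1 j le_rfl
  ext e
  simp [Step.mem_apply, Step.new, Step.old, addLink, addSpoke]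
  grind

theorem endConfig_succ {j : ℕ} (hj : 2 ≤ j) (hF : FullSpec j) :
    endConfig (j + 1) = final (midConfig (j + 1)) (tour (j + 1) false) := by
  rw [endConfig, tour_true hj, pathConfig_succ hj, final_append, final_cons]
  change final (Step.apply _ (final (addLink j _) _)) _ = _
  rw [(addLink_segment hj hF).2.2, apply_addLink hF.isTree_end.sub]
  rfl

/-- The trees where $v_{j+1}$ is a leaf on $v_j$ copy the listing for $j$; one step turns the link
of this leaf into a spoke, and the half listing supplies the rest. -/
theorem fullSpec_succ {j : ℕ} (hj : 2 ≤ j) (hF : FullSpec j) (hH : HalfSpec (j + 1)) :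
    FullSpec (j + 1) := by
  have hE := embeds_addLink hj
  have hpath : pathConfig (j + 1) = addLink j (pathConfig j) := pathConfig_succ hj
  have hlj : link j ∉ edgesUpTo j := by simp
  have hEl := (notMem_of_sub hF.isTree_end.sub).1 j le_rfl
  have hEs := (notMem_of_sub hF.isTree_end.sub).2 (j + 1) (Nat.lt_succ_self _)
  have hmid := midConfig_eq j
  obtain ⟨W, hW⟩ : ∃ W : Finset Config, ∀ X, X ∈ W ↔ IsTree (j + 1) X ∧ spoke (j + 1) ∈ X :=
    ⟨(trees (midConfig (j + 1)) (tour (j + 1) false)).toFinset, by simp [hH.mem_trees]⟩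
  obtain ⟨f1, f2, f3⟩ := addLink_segment hj hF
  obtain ⟨b1, -, -⟩ := hE.segment_full_rev (W := W) hF (fun T hT hp ht =>
    liftsTop_insert hlj (Nat.le_succ j) hT.sub rfl hp fun a h1 h2 h3 h4 => by
      have hs := (notMem_of_sub hT.sub).2 (j + 1) (Nat.lt_succ_self _)
      have hr := h2.of_hub_left h1 (by
        simp only [Finset.mem_insert, not_or]
        exact ⟨by simp; omega, hp.2.2⟩) h3
      -- The competitor removes `link j`, leaving $v_{j+1}$ with neither spoke nor link to $v_j$.
      exfalso
      rcases h4.spoke_or_link hj with h | h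
      · rw [Step.spoke_mem_apply (by omega)] at h
        simp [hs] at h
      · have ho : a.old = link j := by rw [Step.old, hr, h1]; rfl
        rw [Step.mem_apply, ho] at h
        simp only [ne_eq, not_true, false_and, or_false] at h
        exact h3.2.2 (h ▸ Finset.mem_insert_self _ _)) (fun X hX h => by
          have := ((isTree_addLink hj).1 ⟨X, hX, rfl⟩).2
          exact this ((hW _).1 h).2)
  have hU : ∀ X ∈ trees (midConfig (j + 1)) (tour (j + 1) false),
      X ∉ (trees (addLink j (pathConfig j)) (tour j true)).toFinset := by
    intro X hX
    rw [List.mem_toFinset, f2]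
    exact fun h => h.2 ((hH.mem_trees X).1 hX).2
  have hall : ∀ X, X ∈ trees (pathConfig (j + 1)) (tour (j + 1) true) ↔ IsTree (j + 1) X := by
    intro X
    rw [tour_true hj, mem_trees_append_cons, hpath, f3, f2]
    rw [apply_addLink hF.isTree_end.sub, ← hmid, hH.mem_trees]
    tauto
  refine ⟨?_, ?_, hall⟩
  · rw [tour_true hj, hpath]
    refine GreedyRun.glue (B := midConfig (j + 1)) f1 f3 ?_ ?_ hH.mid.1 ?_ ?_
      (hH.forward.enlarge hU)
    · exact apply_addLink hF.isTree_end.sub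
    · refine ⟨?_, ?_, ?_⟩ <;> simp [Step.new, Step.old, addLink, hEs]
      omega
    · rw [f2]
      exact fun h => h.2 hH.mid.2
    · intro a ha hp ht
      rw [f2]
      refine ⟨ht, ?_⟩
      rcases ha with ha | ha
      · rw [Step.spoke_mem_apply ha]
        simp [addLink, hEs]
      · exfalso
        have := Step.Before.of_left_hub (Or.inr ha) ha.1 hp
        subst this
        have := hp.2.1
        simp [Step.new] at this
  · rw [tour_true hj, revSteps_append, revSteps_cons, List.append_assoc, List.singleton_append]
    have hr := hH.mem_trees_revSteps
    refine GreedyRun.glue (A := midConfig (j + 1)) (B := addLink j (endConfig j)) hH.backward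
      hH.final_revSteps ?_ ?_ ((isTree_addLink hj).1 ⟨_, hF.isTree_end, rfl⟩).1 ?_ ?_ ?_
    · rw [hmid]
      ext e
      simp [Step.mem_apply, Step.new, Step.old, Step.inv, addLink, addSpoke]
      grind
    · rw [hmid]
      refine ⟨?_, ?_, ?_⟩ <;> simp [Step.new, Step.old, Step.inv, addSpoke, hEl]
      omega
    · rw [hr]
      exact fun h => ((isTree_addLink hj).1 ⟨_, hF.isTree_end, rfl⟩).2 h.2
    · intro a ha hp ht
      rw [hr]
      refine ⟨ht, ?_⟩
      rcases ha with ha | ha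
      · exact (Step.spoke_mem_apply ha).2 hH.mid.2
      · exfalso
        have hr := Step.Before.of_hub_left (Or.inr ha) ha.1 (by
          rw [hmid]; simp [addSpoke, hEl]) hp
        have := (notMem_of_sub hH.mid.1.sub).1 (j + 1) le_rfl
        have ho : a.old = link (j + 1) := by rw [Step.old, hr, ha.1]; rfl
        exact this (ho ▸ hp.1)
    · have : W = (trees (endConfig (j + 1)) (revSteps (tour (j + 1) false))).toFinset := by
        ext X
        simp [hW, hr]
      exact this ▸ b1

/-! ### The half listing: three blocks and two junctions -/

def Dir.swap : Dir → Dir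
  | left => left
  | right => hub
  | hub => right

/-- The step in which the roles of `v_{j+1}` and `v_∞` for the pivot `v_j` are exchanged. -/
def swapStep (j : ℕ) (m : Step) : Step :=
  if m.pivot = j then ⟨j, m.removed.swap, m.added.swap⟩ else m

theorem swapStep_inv (j : ℕ) (m : Step) : swapStep j m.inv = (swapStep j m).inv := by
  unfold swapStep Step.inv
  simp only
  split_ifs <;> rfl

theorem revSteps_map_swapStep (j : ℕ) (l : List Step) :
    revSteps (l.map (swapStep j)) = (revSteps l).map (swapStep j) := by
  simp only [revSteps, List.map_map, List.map_reverse]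
  congr 1
  refine List.map_congr_left fun m _ => ?_
  simp [swapStep_inv]

theorem map_swapStep_of_lt {j : ℕ} {l : List Step} (h : ∀ m ∈ l, m.pivot < j) :
    l.map (swapStep j) = l := by
  conv_rhs => rw [← List.map_id l]
  refine List.map_congr_left fun m hm => ?_
  have := (h m hm).ne
  simp [swapStep, this]

/-- The connecting step is the only one with pivot $v_{j+1}$, so the exchange changes nothing else
and yields the moves of `gen (j + 1) true true`. -/
theorem map_swapStep_tour {j : ℕ} (hj : 2 ≤ j) : (tour (j + 1) true).map (swapStep (j + 1)) =
    tour j true ++ ⟨j + 1, left, right⟩ :: tour (j + 1) false := by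
  rw [tour_true hj, List.map_append, List.map_cons, map_swapStep_of_lt, map_swapStep_of_lt]
  · simp [swapStep, Dir.swap]
  · exact (pivot_lt_of_mem_tour _).1
  · intro m hm
    rcases (pivot_lt_of_mem_tour _).2 m hm with h | rfl
    · omega
    · exact Nat.lt_succ_self _

/-- The blocks are: no `link (j + 1)`; `link (j + 1)` without the spoke of $v_j$; both edges. -/
theorem tour_false_eq {j : ℕ} (hj : 3 ≤ j) : tour (j + 2) false =
    (revSteps (tour (j + 1) true) ++ ⟨j + 1, left, right⟩ :: (tour j true).map (swapStep j)) ++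
      ⟨j, right, hub⟩ :: revSteps (tour j false) := by
  obtain ⟨j, rfl⟩ := Nat.exists_eq_add_of_le' hj
  rw [tour_false, map_swapStep_tour (by omega)]
  simp

theorem mem_addBothSwap {j : ℕ} {T : Config} (hT : T ⊆ edgesUpTo j) {e : Edge} :
    e ∈ addBothSwap j T ↔ e = link (j + 1) ∨ e = spoke (j + 2) ∨
      (e ≠ spoke j ∧ e ≠ link j ∧ e ∈ T ∨ e = link j ∧ spoke j ∈ T) := by
  rw [addBothSwap, mem_addBoth, mem_swapSpoke ((notMem_of_sub hT).1 j le_rfl)]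

theorem liftsTop_swap {j : ℕ} (hj : 2 ≤ j) {W : Finset Config} {T : Config}
    (hT : T ⊆ edgesUpTo j) (hp : (⟨j, left, hub⟩ : Step).IsPivot j T) :
    LiftsTop j (j + 2) (addBothSwap j) W (swapStep j ⟨j, left, hub⟩) ⟨j, left, hub⟩ T := by
  have hs : swapStep j ⟨j, left, hub⟩ = ⟨j, left, right⟩ := by simp [swapStep, Dir.swap]
  rw [hs]
  have h1 : link (j - 1) ∈ T := hp.1
  have h3 : spoke j ∉ T := hp.2.2
  have hl := (notMem_of_sub hT).1 j le_rfl
  have hsub := Step.apply_sub hT hp.2.1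
  refine ⟨rfl, ⟨?_, ?_, ?_⟩, ?_, fun a h1 h2 h3 => absurd h3 (h2.of_left_right h1)⟩
  · simp only [mem_addBothSwap hT, Step.old, incident_left]
    have : link (j - 1) ≠ link j := by simp; omega
    simp [h1, this]
  · simp [Step.new]
    omega
  · simp [mem_addBothSwap hT, Step.new, h3]
  · ext e
    have : link (j - 1) ≠ link (j + 1) := by simp
    simp only [Step.mem_apply, mem_addBothSwap hT, mem_addBothSwap hsub]
    simp only [Step.old, Step.new, incident_left, incident_right, incident_hub]
    grind

/-- Only removals of the left edge precede right to left, and that edge is absent. As for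
`liftsTop_swap`, there is no competitor at $v_j$, so `W` is arbitrary. -/
theorem liftsTop_swap_rev {j : ℕ} (hj : 2 ≤ j) {W : Finset Config} {T : Config}
    (hT : T ⊆ edgesUpTo j) (hp : (⟨j, hub, left⟩ : Step).IsPivot j T) :
    LiftsTop j (j + 2) (addBothSwap j) W (swapStep j ⟨j, hub, left⟩) ⟨j, hub, left⟩ T := by
  have hs : swapStep j ⟨j, hub, left⟩ = ⟨j, right, left⟩ := by simp [swapStep, Dir.swap]
  rw [hs]
  have h1 : spoke j ∈ T := hp.1
  have h2 : link (j - 1) ∈ edgesUpTo j := hp.2.1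
  have h3 : link (j - 1) ∉ T := hp.2.2
  have hl := (notMem_of_sub hT).1 j le_rfl
  have hsub := Step.apply_sub hT hp.2.1
  have h4 : link (j - 1) ∉ addBothSwap j T := by
    rw [mem_addBothSwap hT]
    simp [h3]
    omega
  refine ⟨rfl, ⟨?_, edgesUpTo_mono (by omega) h2, h4⟩, ?_,
    fun a h1 h2 h3 => absurd h3 (h2.of_right_left h1 h4)⟩
  · simp [mem_addBothSwap hT, Step.old, h1]
  · ext e
    have : link (j - 1) ≠ link (j + 1) := by simp
    have : link (j - 1) ≠ link j := by simp; omega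
    simp only [Step.mem_apply, mem_addBothSwap hT, mem_addBothSwap hsub]
    simp only [Step.old, Step.new, incident_left, incident_right, incident_hub]
    grind

theorem addBothSwap_segment {j : ℕ} (hj : 2 ≤ j) {W : Finset Config} (hF : FullSpec j)
    (hW : ∀ X, IsTree j X → addBothSwap j X ∉ W) :
    GreedyRun (j + 2) ({addBothSwap j (pathConfig j)} ∪ W) (addBothSwap j (pathConfig j))
        ((tour j true).map (swapStep j)) ∧
      (∀ X, X ∈ trees (addBothSwap j (pathConfig j)) ((tour j true).map (swapStep j)) ↔
        IsTree (j + 2) X ∧ spoke (j + 2) ∈ X ∧ link (j + 1) ∈ X ∧ spoke j ∉ X) ∧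
      final (addBothSwap j (pathConfig j)) ((tour j true).map (swapStep j)) =
        addBothSwap j (endConfig j) := by
  have := (embeds_addBothSwap hj).segment (ψ := swapStep j) (W := W) hF.isTree_path
    (fun m hm => ?_) (fun X hX => hW X ((hF.mem_trees X).1 hX)) hF.forward
  · simp only [hF.mem_trees, isTree_addBothSwap hj] at this
    exact this
  · rcases (pivot_lt_of_mem_tour j).2 m hm with h | rfl
    · exact Or.inl ⟨h, by simp [swapStep, h.ne]⟩
    · exact Or.inr ⟨rfl, fun T hT hp _ => liftsTop_swap hj hT.sub hp⟩

theorem addBothSwap_segment_rev {j : ℕ} (hj : 2 ≤ j) {W : Finset Config} (hF : FullSpec j)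
    (hW : ∀ X, IsTree j X → addBothSwap j X ∉ W) :
    GreedyRun (j + 2) ({addBothSwap j (endConfig j)} ∪ W) (addBothSwap j (endConfig j))
        (revSteps ((tour j true).map (swapStep j))) ∧
      (∀ X, X ∈ trees (addBothSwap j (endConfig j)) (revSteps ((tour j true).map (swapStep j))) ↔
        IsTree (j + 2) X ∧ spoke (j + 2) ∈ X ∧ link (j + 1) ∈ X ∧ spoke j ∉ X) ∧
      final (addBothSwap j (endConfig j)) (revSteps ((tour j true).map (swapStep j))) =
        addBothSwap j (pathConfig j) := by
  rw [revSteps_map_swapStep]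
  have := (embeds_addBothSwap hj).segment (ψ := swapStep j) (W := W) hF.isTree_end
    (fun m hm => ?_) (fun X hX => hW X ((hF.mem_trees_revSteps X).1 hX)) hF.backward
  · simp only [hF.mem_trees_revSteps, isTree_addBothSwap hj, hF.final_revSteps] at this
    exact this
  · rw [mem_revSteps] at hm
    rcases (pivot_lt_of_mem_tour j).2 _ hm with h | h
    · exact Or.inl ⟨h, by have := h.ne; simp only [Step.inv] at this; simp [swapStep, this]⟩
    · obtain ⟨p, r, a⟩ := m
      simp only [Step.inv, Step.mk.injEq] at h
      obtain ⟨rfl, rfl, rfl⟩ := h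
      exact Or.inr ⟨rfl, fun T hT hp _ => liftsTop_swap_rev hj hT.sub hp⟩

/-- The four edges form the cycle $v_\infty v_jv_{j+1}v_{j+2}$. -/
theorem not_isTree_of_spoke_link {j : ℕ} (hj : 2 ≤ j) {X : Config} (h₁ : link (j + 1) ∈ X)
    (h₂ : spoke (j + 2) ∈ X) (h₃ : link j ∈ X) (h₄ : spoke j ∈ X) : ¬ IsTree (j + 2) X := by
  intro h
  rcases ((good_addBoth_iff hj h₁ h₂).1 h.good).2 with h | h
  · exact spoke_notMem_of_good_false h.2 h₄
  · exact h.1 h₃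

theorem Step.IsPivot.inv {k : ℕ} {m : Step} {A B : Config} (h : m.IsPivot k A)
    (hA : A ⊆ edgesUpTo k) (hB : m.apply A = B) : m.inv.IsPivot k B := by
  subst hB
  obtain ⟨h1, h2, h3⟩ := h
  refine ⟨mem_apply.2 (Or.inl rfl), hA h1, fun h => ?_⟩
  rcases mem_apply.1 h with h | h
  · exact h3 (h ▸ h1)
  · exact h.1 rfl

/-- The trees at the two connecting steps of `tour (j + 2) false`, and these steps. -/
structure Junctions (j : ℕ) : Prop where
  apply₁ : (⟨j + 1, left, right⟩ : Step).apply (addSpoke (j + 1) (pathConfig (j + 1))) =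
    addBothSwap j (pathConfig j)
  isPivot₁ : (⟨j + 1, left, right⟩ : Step).IsPivot (j + 2)
    (addSpoke (j + 1) (pathConfig (j + 1)))
  apply₂ : (⟨j, right, hub⟩ : Step).apply (addBothSwap j (endConfig j)) = addBoth j (endConfig j)
  isPivot₂ : (⟨j, right, hub⟩ : Step).IsPivot (j + 2) (addBothSwap j (endConfig j))
  spec₁ : IsTree (j + 2) (addSpoke (j + 1) (pathConfig (j + 1))) ∧
    spoke (j + 2) ∈ addSpoke (j + 1) (pathConfig (j + 1)) ∧
    link (j + 1) ∉ addSpoke (j + 1) (pathConfig (j + 1))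
  spec₁' : IsTree (j + 2) (addBothSwap j (pathConfig j)) ∧
    spoke (j + 2) ∈ addBothSwap j (pathConfig j) ∧ link (j + 1) ∈ addBothSwap j (pathConfig j) ∧
    spoke j ∉ addBothSwap j (pathConfig j)
  spec₂ : IsTree (j + 2) (addBothSwap j (endConfig j)) ∧
    spoke (j + 2) ∈ addBothSwap j (endConfig j) ∧ link (j + 1) ∈ addBothSwap j (endConfig j) ∧
    spoke j ∉ addBothSwap j (endConfig j)
  spec₂' : IsTree (j + 2) (addBoth j (endConfig j)) ∧
    spoke (j + 2) ∈ addBoth j (endConfig j) ∧ link (j + 1) ∈ addBoth j (endConfig j) ∧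
    spoke j ∈ addBoth j (endConfig j)

theorem junctions {j : ℕ} (hj : 3 ≤ j) (hF : FullSpec j) (hH : HalfSpec j)
    (hF' : FullSpec (j + 1)) : Junctions j := by
  have hj2 : 2 ≤ j := by omega
  have hPsub := hF.isTree_path.sub
  have hEsub := hF.isTree_end.sub
  have hPsub' := hF'.isTree_path.sub
  -- This fails for $j=2$, hence the assumption $3\le j$.
  have hPj : spoke j ∉ pathConfig j := by simp [pathConfig]; omega
  have hPl := (notMem_of_sub hPsub).1
  have hEl := (notMem_of_sub hEsub).1
  have hEj : spoke j ∈ endConfig j := hH.end.2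
  have hpath := pathConfig_succ hj2
  have c₁ : (⟨j + 1, left, right⟩ : Step).apply (addSpoke (j + 1) (pathConfig (j + 1))) =
      addBothSwap j (pathConfig j) := by
    have := hPl j le_rfl
    ext e
    rw [Step.mem_apply, mem_addBothSwap hPsub, addSpoke, hpath]
    simp [Step.new, Step.old, hPj]
    grind
  have p₁ : (⟨j + 1, left, right⟩ : Step).IsPivot (j + 2)
      (addSpoke (j + 1) (pathConfig (j + 1))) := by
    have := (notMem_of_sub hPsub').1 (j + 1) le_rfl
    refine ⟨?_, ?_, ?_⟩
    · simp [Step.old, addSpoke, hpath]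
    · simp [Step.new]; omega
    · simp [Step.new, addSpoke, this]
  have c₂ : (⟨j, right, hub⟩ : Step).apply (addBothSwap j (endConfig j)) =
      addBoth j (endConfig j) := by
    have := hEl j le_rfl
    ext e
    rw [Step.mem_apply, mem_addBothSwap hEsub, mem_addBoth]
    simp [Step.new, Step.old, hEj]
    grind
  have p₂ : (⟨j, right, hub⟩ : Step).IsPivot (j + 2) (addBothSwap j (endConfig j)) := by
    refine ⟨?_, ?_, ?_⟩
    · simp [Step.old, mem_addBothSwap hEsub, hEj]
    · simp [Step.new]; omega
    · simp [Step.new, mem_addBothSwap hEsub]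
  exact ⟨c₁, p₁, c₂, p₂, (isTree_addSpoke (by omega)).1 ⟨_, hF'.isTree_path, rfl⟩,
    (isTree_addBothSwap hj2).1 ⟨_, hF.isTree_path, rfl⟩,
    (isTree_addBothSwap hj2).1 ⟨_, hF.isTree_end, rfl⟩,
    (isTree_addBoth hj2).1 ⟨_, ⟨hF.isTree_end, hEj⟩, rfl⟩⟩

theorem halfSpec_forward {j : ℕ} (hj : 3 ≤ j) (hF : FullSpec j) (hH : HalfSpec j)
    (hF' : FullSpec (j + 1)) :
    GreedyRun (j + 2) {midConfig (j + 2)} (midConfig (j + 2)) (tour (j + 2) false) ∧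
    (∀ X, X ∈ trees (midConfig (j + 2)) (tour (j + 2) false) ↔
      IsTree (j + 2) X ∧ spoke (j + 2) ∈ X) ∧
    final (midConfig (j + 2)) (tour (j + 2) false) = addBoth j (midConfig j) := by
  have hj2 : 2 ≤ j := by omega
  have hA := fun X => @isTree_addSpoke (j + 1) (by omega) X
  have hB := fun X => @isTree_addBoth j hj2 X
  have hBS := fun X => @isTree_addBothSwap j hj2 X
  obtain ⟨c₁, p₁, c₂, p₂, tA, tBS, tBS', tB⟩ := junctions hj hF hH hF'
  -- Without this link, right to left at $v_j$ would precede the second connecting step.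
  have hElj : link (j - 1) ∈ endConfig j := hH.link_mem
  have hEsub := hF.isTree_end.sub
  have hmid : midConfig (j + 2) = addSpoke (j + 1) (endConfig (j + 1)) := rfl
  obtain ⟨f1, m1, q1⟩ := (embeds_addSpoke (j := j + 1) (by omega)).segment_full_rev (W := ∅) hF'
    (fun T hT hp ht => liftsTop_insert (by simp) (Nat.le_succ _) hT.sub rfl hp
      fun a h1 h2 h3 h4 => by
        have hr := h2.of_hub_left h1 (by
          simp only [Finset.mem_insert, not_or]
          exact ⟨by simp, hp.2.2⟩) h3
        have ho : a.old = link (j + 1) := by rw [Step.old, hr, h1]; rfl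
        have := ho ▸ h3.1
        simp [(notMem_of_sub hT.sub).1 (j + 1) le_rfl] at this) (by simp)
  simp only [hA] at m1
  rw [Finset.union_empty] at f1
  obtain ⟨f2, m2, q2⟩ := addBothSwap_segment (W := (trees (addSpoke (j + 1)
    (endConfig (j + 1))) (revSteps (tour (j + 1) true))).toFinset) hj2 hF (fun X hX h => by
      rw [List.mem_toFinset, m1] at h
      exact h.2.2 ((hBS _).1 ⟨X, hX, rfl⟩).2.2.1)
  have F12 : GreedyRun (j + 2) {midConfig (j + 2)} (midConfig (j + 2))
      (revSteps (tour (j + 1) true) ++ ⟨j + 1, left, right⟩ ::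
        (tour j true).map (swapStep j)) := by
    refine f1.glue q1 c₁ p₁ tBS.1 ?_ ?_ f2
    · rw [m1]
      exact fun h => h.2.2 tBS.2.2.1
    · intro a ha hp ht
      rw [m1]
      rcases ha with ha | ha
      · refine ⟨ht, ?_, ?_⟩
        · exact (Step.spoke_mem_apply (ha.trans (Nat.lt_succ_self _))).2 tA.2.1
        · exact fun h => tA.2.2 ((Step.link_mem_apply ha).1 h)
      · exact absurd hp (Step.Before.of_left_right (Or.inr ha) ha.1)
  have M12 : ∀ X, X ∈ trees (midConfig (j + 2)) (revSteps (tour (j + 1) true) ++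
      ⟨j + 1, left, right⟩ :: (tour j true).map (swapStep j)) ↔
      IsTree (j + 2) X ∧ spoke (j + 2) ∈ X ∧ ¬ (link (j + 1) ∈ X ∧ spoke j ∈ X) := by
    intro X
    rw [mem_trees_append_cons, hmid, q1, c₁, m1, m2]
    by_cases h1 : link (j + 1) ∈ X <;> by_cases h2 : spoke j ∈ X <;> simp [h1, h2]
  have Q12 : final (midConfig (j + 2)) (revSteps (tour (j + 1) true) ++
      ⟨j + 1, left, right⟩ :: (tour j true).map (swapStep j)) = addBothSwap j (endConfig j) := by
    rw [final_append, final_cons, hmid, q1, c₁, q2]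
  obtain ⟨f3, m3, q3⟩ := (embeds_addBoth hj2).segment_half_rev (W := (trees (midConfig (j + 2))
    (revSteps (tour (j + 1) true) ++ ⟨j + 1, left, right⟩ ::
      (tour j true).map (swapStep j))).toFinset) hH (fun X hX hs h => by
      rw [List.mem_toFinset, M12] at h
      exact h.2.2 ((hB _).1 ⟨X, ⟨hX, hs⟩, rfl⟩).2.2)
  simp only [hB] at m3
  have hforward : GreedyRun (j + 2) {midConfig (j + 2)} (midConfig (j + 2))
      (tour (j + 2) false) := by
    rw [tour_false_eq hj]
    refine F12.glue Q12 c₂ p₂ tB.1 ?_ ?_ f3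
    · rw [M12]
      exact fun h => h.2.2 tB.2.2
    · intro a ha hp ht
      have hl : link j ∈ addBothSwap j (endConfig j) := p₂.1
      rw [M12]
      rcases ha with ha | ha
      · refine ⟨ht, ?_, ?_⟩
        · exact (Step.spoke_mem_apply (ha.trans (by simp))).2 tBS'.2.1
        · exact fun h => tBS'.2.2.2 ((Step.spoke_mem_apply ha).1 h.2)
      -- The one competitor left at $v_j$ adds its spoke while keeping `link j`, closing a cycle.
      · obtain rfl := Step.Before.of_right_hub (Or.inr ha) ha.1 (by
          rw [mem_addBothSwap hEsub]
          simp [hElj]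
          omega) hl hp
        refine absurd ht (not_isTree_of_spoke_link hj2 ?_ ?_ ?_ ?_)
        · exact (Step.link_mem_apply (Nat.lt_succ_self _)).2 tBS'.2.2.1
        · exact (Step.spoke_mem_apply (by simp)).2 tBS'.2.1
        · refine Step.mem_apply.2 (Or.inr ⟨?_, hl⟩)
          simp [Step.old]
          omega
        · exact Step.mem_apply.2 (Or.inl rfl)
  have hmem : ∀ X, X ∈ trees (midConfig (j + 2)) (tour (j + 2) false) ↔
      IsTree (j + 2) X ∧ spoke (j + 2) ∈ X := by
    intro X
    rw [tour_false_eq hj, mem_trees_append_cons, Q12, c₂, M12, m3]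
    by_cases h1 : link (j + 1) ∈ X <;> by_cases h2 : spoke j ∈ X <;> simp [h1, h2]
  have hfin : final (midConfig (j + 2)) (tour (j + 2) false) = addBoth j (midConfig j) := by
    rw [tour_false_eq hj, final_append, final_cons, Q12, c₂, q3]
  exact ⟨hforward, hmem, hfin⟩

theorem halfSpec_backward {j : ℕ} (hj : 3 ≤ j) (hF : FullSpec j) (hH : HalfSpec j)
    (hF' : FullSpec (j + 1)) (hend : endConfig (j + 2) = addBoth j (midConfig j)) :
    GreedyRun (j + 2) {endConfig (j + 2)} (endConfig (j + 2)) (revSteps (tour (j + 2) false)) := by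
  have hj2 : 2 ≤ j := by omega
  have hA := fun X => @isTree_addSpoke (j + 1) (by omega) X
  have hB := fun X => @isTree_addBoth j hj2 X
  have hBS := fun X => @isTree_addBothSwap j hj2 X
  obtain ⟨c₁, p₁, c₂, p₂, tA, tBS, tBS', tB⟩ := junctions hj hF hH hF'
  have hElj : link (j - 1) ∈ endConfig j := hH.link_mem
  have e₁ := Step.inv_apply_apply p₁
  have e₂ := Step.inv_apply_apply p₂
  rw [c₁] at e₁
  rw [c₂] at e₂
  have d₁ := p₁.inv tA.1.sub c₁
  have d₂ := p₂.inv tBS'.1.sub c₂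
  obtain ⟨b1, n1, r1⟩ := (embeds_addBoth hj2).segment_half (W := ∅) hH (by simp)
  simp only [hB] at n1
  rw [Finset.union_empty, ← hend] at b1
  rw [← hend] at n1 r1
  obtain ⟨b2, n2, r2⟩ := addBothSwap_segment_rev
    (W := (trees (endConfig (j + 2)) (tour j false)).toFinset) hj2 hF (fun X hX h => by
      rw [List.mem_toFinset, n1] at h
      exact ((hBS _).1 ⟨X, hX, rfl⟩).2.2.2 h.2.2.2)
  have B12 : GreedyRun (j + 2) {endConfig (j + 2)} (endConfig (j + 2))
      (tour j false ++ ⟨j, hub, right⟩ :: revSteps ((tour j true).map (swapStep j))) := by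
    refine b1.glue r1 e₂ d₂ tBS'.1 ?_ ?_ b2
    · rw [n1]
      exact fun h => tBS'.2.2.2 h.2.2.2
    · intro a ha hp ht
      rw [n1]
      have hlj : link j ∉ addBoth j (endConfig j) := d₂.2.2
      rcases ha with ha | ha
      · exact ⟨ht, (Step.spoke_mem_apply (ha.trans (show j < j + 2 by simp))).2 tB.2.1,
          (Step.link_mem_apply (ha.trans (Nat.lt_succ_self j))).2 tB.2.2.1,
          (Step.spoke_mem_apply ha).2 tB.2.2.2⟩
      · obtain rfl := Step.Before.of_hub_right (Or.inr ha) ha.1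
          (mem_addBoth.2 (Or.inr (Or.inr hElj))) hlj tB.2.2.2 hp
        refine absurd ht (not_isTree_of_spoke_link hj2 ?_ ?_ ?_ ?_)
        · exact (Step.link_mem_apply (Nat.lt_succ_self j)).2 tB.2.2.1
        · exact (Step.spoke_mem_apply (show j < j + 2 by simp)).2 tB.2.1
        · exact Step.mem_apply.2 (Or.inl rfl)
        · exact Step.mem_apply.2 (Or.inr ⟨by simp [Step.old], tB.2.2.2⟩)
  have N12 : ∀ X, X ∈ trees (endConfig (j + 2)) (tour j false ++
      ⟨j, hub, right⟩ :: revSteps ((tour j true).map (swapStep j))) ↔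
      IsTree (j + 2) X ∧ spoke (j + 2) ∈ X ∧ link (j + 1) ∈ X := by
    intro X
    rw [mem_trees_append_cons, r1]
    have : (⟨j, hub, right⟩ : Step).apply (addBoth j (endConfig j)) = _ := e₂
    rw [this, n1, n2]
    by_cases h1 : link (j + 1) ∈ X <;> by_cases h2 : spoke j ∈ X <;> simp [h1, h2]
  have R12 : final (endConfig (j + 2)) (tour j false ++
      ⟨j, hub, right⟩ :: revSteps ((tour j true).map (swapStep j))) =
      addBothSwap j (pathConfig j) := by
    rw [final_append, final_cons, r1]
    have : (⟨j, hub, right⟩ : Step).apply (addBoth j (endConfig j)) = _ := e₂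
    rw [this, r2]
  obtain ⟨b3, n3, r3⟩ := (embeds_addSpoke (j := j + 1) (by omega)).segment_full
    (W := (trees (endConfig (j + 2)) (tour j false ++
      ⟨j, hub, right⟩ :: revSteps ((tour j true).map (swapStep j)))).toFinset) hF'
    (fun T hT hp ht => liftsTop_insert (by simp) (Nat.le_succ _) hT.sub rfl hp
      fun a h1 h2 h3 h4 => by
        -- Here a competitor can give a tree: it moves $v_{j+1}$ from $v_j$ to $v_{j+2}$. In the
        -- backward direction all trees with both edges at $v_{j+2}$ are already listed, so the
        -- result lies in `W`.
        obtain rfl := h2.of_left_hub h1 h3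
        rw [List.mem_toFinset, N12]
        refine ⟨h4, ?_, Step.mem_apply.2 (Or.inl rfl)⟩
        exact (Step.spoke_mem_apply (Nat.lt_succ_self _)).2 (Finset.mem_insert_self _ _))
    (fun X hX h => by
      rw [List.mem_toFinset, N12] at h
      exact ((hA _).1 ⟨X, hX, rfl⟩).2.2 h.2.2)
  have hrev : revSteps (tour (j + 2) false) =
      (tour j false ++ ⟨j, hub, right⟩ :: revSteps ((tour j true).map (swapStep j))) ++
        ⟨j + 1, right, left⟩ :: tour (j + 1) true := by
    rw [tour_false_eq hj]
    simp [Step.inv]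
  rw [hrev]
  refine B12.glue R12 e₁ d₁ tA.1 ?_ ?_ b3
  · rw [N12]
    exact fun h => tA.2.2 h.2.2
  · intro a ha hp ht
    rw [N12]
    rcases ha with ha | ha
    · exact ⟨ht, (Step.spoke_mem_apply (ha.trans (Nat.lt_succ_self (j + 1)))).2 tBS.2.1,
        (Step.link_mem_apply ha).2 tBS.2.2.1⟩
    · exact absurd hp (Step.Before.of_right_left (Or.inr ha) ha.1 d₁.2.2)

theorem halfSpec_add_two {j : ℕ} (hj : 3 ≤ j) (hF : FullSpec j) (hH : HalfSpec j)
    (hF' : FullSpec (j + 1)) : HalfSpec (j + 2) := by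
  obtain ⟨hf, hm, hfin⟩ := halfSpec_forward hj hF hH hF'
  have hend : endConfig (j + 2) = addBoth j (midConfig j) := by
    rw [endConfig_succ (by omega) hF', hfin]
  exact ⟨hf, by rw [hfin, hend], halfSpec_backward hj hF hH hF' hend, hm,
    by rw [hend]; simp [mem_addBoth]⟩

theorem fullSpec {n : ℕ} (hn : 2 ≤ n) : FullSpec n := by
  -- Two consecutive sizes are carried, since the half listing for $j+2$ uses the listings for $j$
  -- and $j+1$.
  suffices h : ∀ k, FullSpec (k + 3) ∧ HalfSpec (k + 3) ∧ FullSpec (k + 4) ∧ HalfSpec (k + 4) by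
    obtain rfl | hn := hn.eq_or_lt
    · exact fullSpec_two
    · obtain ⟨k, rfl⟩ := Nat.exists_eq_add_of_le' (show 3 ≤ n from hn)
      exact (h k).1
  intro k
  induction k with
  | zero =>
    have h3 := fullSpec_succ le_rfl fullSpec_two halfSpec_three
    exact ⟨h3, halfSpec_three, fullSpec_succ (by omega) h3 halfSpec_four, halfSpec_four⟩
  | succ k ih =>
    obtain ⟨h1, h2, h3, h4⟩ := ih
    have h := halfSpec_add_two (by omega) h1 h2 h3
    exact ⟨h3, h4, fullSpec_succ (by omega) h3 h, h⟩

/-! ### From configurations to edge sets -/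

def Edge.toSym : Edge → Sym2 Label
  | spoke i => s((⊤ : Label), (i : Label))
  | link i => s((i : Label), ((i + 1 : ℕ) : Label))

theorem toSym_injective : Function.Injective Edge.toSym := by
  intro e f h
  cases e <;> cases f <;> simp [Edge.toSym, -Nat.cast_add] at h ⊢ <;> grind

def toEdgeSet (T : Config) : EdgeSet := T.image Edge.toSym

theorem toEdgeSet_injective : Function.Injective toEdgeSet :=
  Finset.image_injective toSym_injective

theorem mem_toEdgeSet {T : Config} {e : Edge} : e.toSym ∈ toEdgeSet T ↔ e ∈ T :=
  toSym_injective.mem_finset_image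

theorem toEdgeSet_edgesUpTo (n : ℕ) : toEdgeSet (edgesUpTo n) = fanEdges n := by
  rw [toEdgeSet, edgesUpTo, Finset.image_union, Finset.image_image, Finset.image_image]
  rfl

theorem toEdgeSet_pathConfig (n : ℕ) : toEdgeSet (pathConfig n) = pathTree n := by
  rw [toEdgeSet, pathConfig, Finset.image_insert, Finset.image_image]
  rfl

theorem mem_vertexList {n : ℕ} {v : Label} :
    v ∈ vertexList n ↔ v = ⊤ ∨ ∃ i : ℕ, (2 ≤ i ∧ i ≤ n) ∧ v = i := by
  simp only [vertexList, List.mem_append, List.mem_map, List.mem_range'_1, List.mem_singleton]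
  constructor
  · rintro (⟨i, hi, rfl⟩ | h)
    · exact Or.inr ⟨i, by omega, rfl⟩
    · exact Or.inl h
  · rintro (h | ⟨i, hi, rfl⟩)
    · exact Or.inr h
    · exact Or.inl ⟨i, by omega, rfl⟩

theorem vertexList_pairwise (n : ℕ) : (vertexList n).Pairwise (· < ·) := by
  rw [vertexList, List.pairwise_append]
  refine ⟨?_, List.pairwise_singleton _ _, ?_⟩
  · rw [List.pairwise_map]
    exact (List.pairwise_lt_range' (s := 2) (n := n - 1)).imp fun h => by exact_mod_cast h
  · simp only [List.mem_map, List.mem_singleton]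
    rintro _ ⟨i, -, rfl⟩ _ rfl
    exact ENat.natCast_lt_top i

/-! ### The scan recognises exactly the spanning trees -/

section Graph

variable {n : ℕ}

abbrev Vertex (n : ℕ) := {v : Label | v ∈ vertexList n}

def vert {i : ℕ} (hi : 2 ≤ i ∧ i ≤ n) : Vertex n :=
  ⟨(i : Label), mem_vertexList.2 (Or.inr ⟨i, hi, rfl⟩)⟩

def hubVert (n : ℕ) : Vertex n := ⟨⊤, mem_vertexList.2 (Or.inl rfl)⟩

theorem vertex_cases (v : Vertex n) :
    v = hubVert n ∨ ∃ (i : ℕ) (hi : 2 ≤ i ∧ i ≤ n), v = vert hi := by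
  obtain ⟨v, hv⟩ := v
  rcases mem_vertexList.1 hv with rfl | ⟨i, hi, rfl⟩
  · exact Or.inl rfl
  · exact Or.inr ⟨i, hi, rfl⟩

theorem graphOn_adj {E : EdgeSet} {a b : Vertex n} :
    (graphOn n E).Adj a b ↔ s(a.1, b.1) ∈ E ∧ a.1 ≠ b.1 := by
  simp [graphOn]

theorem adj_spoke {T : Config} {i : ℕ} (hi : 2 ≤ i ∧ i ≤ n) (h : spoke i ∈ T) :
    (graphOn n (toEdgeSet T)).Adj (hubVert n) (vert hi) := by
  rw [graphOn_adj]
  exact ⟨mem_toEdgeSet.2 h, ENat.top_ne_natCast i⟩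

theorem adj_link {T : Config} {i : ℕ} (hi : 2 ≤ i ∧ i ≤ n) (hi' : 2 ≤ i + 1 ∧ i + 1 ≤ n)
    (h : link i ∈ T) : (graphOn n (toEdgeSet T)).Adj (vert hi) (vert hi') := by
  rw [graphOn_adj]
  refine ⟨mem_toEdgeSet.2 h, ?_⟩
  simp only [vert, ne_eq, Nat.cast_inj]
  omega

theorem card_vertex (hn : 2 ≤ n) : Nat.card (Vertex n) = n := by
  have h : (vertexList n).Nodup := (vertexList_pairwise n).imp fun h => h.ne
  have hset : {v : Label | v ∈ vertexList n} = ((vertexList n).toFinset : Set Label) := by simp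
  rw [Vertex, Nat.card_coe_set_eq, hset, Set.ncard_coe_finset, List.toFinset_card_of_nodup h]
  simp [vertexList]
  omega

theorem card_edgeSet {T : Config} (hT : T ⊆ edgesUpTo n) :
    Nat.card (graphOn n (toEdgeSet T)).edgeSet = T.card := by
  have hinj : Function.Injective (Sym2.map (Subtype.val : Vertex n → Label)) :=
    Sym2.map.injective Subtype.val_injective
  have himg : Sym2.map (Subtype.val : Vertex n → Label) '' (graphOn n (toEdgeSet T)).edgeSet =
      (toEdgeSet T : Set (Sym2 Label)) := by
    ext e
    constructor
    · rintro ⟨f, hf, rfl⟩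
      induction f using Sym2.ind with
      | _ a b => exact (graphOn_adj.1 hf).1
    · intro he
      obtain ⟨f, hf, rfl⟩ := Finset.mem_image.1 he
      have := hT hf
      cases f with
      | spoke i => 
        have h := spoke_mem_edgesUpTo.1 this
        exact ⟨s(hubVert n, vert h), adj_spoke h hf, rfl⟩
      | link i =>
        have h := link_mem_edgesUpTo.1 this
        have h1 : 2 ≤ i ∧ i ≤ n := by omega
        have h2 : 2 ≤ i + 1 ∧ i + 1 ≤ n := by omega
        exact ⟨s(vert h1, vert h2), adj_link h1 h2 hf, rfl⟩
  rw [Nat.card_coe_set_eq, ← Set.ncard_image_of_injective _ hinj, himg, Set.ncard_coe_finset,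
    toEdgeSet, Finset.card_image_of_injective _ toSym_injective]

theorem edgesUpTo_succ {k : ℕ} (hk : 2 ≤ k) :
    edgesUpTo (k + 1) = insert (link k) (insert (spoke (k + 1)) (edgesUpTo k)) := by
  ext e
  cases e <;> simp <;> omega

/-- The scan describes a forest on $k$ vertices, $v_\infty$ included: one component in state `true`,
two in state `false`, where the run of $v_k$ is still detached. -/
theorem card_of_good {T : Config} {k : ℕ} (hk : 2 ≤ k) :
    (Good T k true = true → (edgesUpTo k ∩ T).card + 1 = k) ∧
      (Good T k false = true → (edgesUpTo k ∩ T).card + 2 = k) := by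
  induction k, hk using Nat.le_induction with
  | base =>
    have : edgesUpTo 2 = {spoke 2} := by decide
    rw [good_two, good_two, this]
    constructor <;> intro h <;> by_cases h2 : spoke 2 ∈ T <;> simp_all
  | succ k hk ih =>
    rw [edgesUpTo_succ hk, good_succ_true hk, good_succ_false hk]
    obtain ⟨ih1, ih2⟩ := ih
    have hcard : (insert (link k) (insert (spoke (k + 1)) (edgesUpTo k)) ∩ T).card =
        (if link k ∈ T then 1 else 0) + (if spoke (k + 1) ∈ T then 1 else 0) +
          (edgesUpTo k ∩ T).card := by
      by_cases h1 : link k ∈ T <;> by_cases h2 : spoke (k + 1) ∈ T <;>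
        simp [h1, h2, Finset.insert_inter_of_mem, Finset.insert_inter_of_notMem] <;> omega
    rw [hcard]
    constructor
    · rintro (⟨h1, h2, h3⟩ | ⟨h1, h2, h3⟩ | ⟨h1, h2, h3⟩)
      · have := ih2 h3; simp [h1, h2]; omega
      · have := ih1 h3; simp [h1, h2]; omega
      · have := ih1 h3; simp [h1, h2]; omega
    · rintro ⟨h1, ⟨h2, h3⟩ | ⟨h2, h3⟩⟩
      · have := ih2 h3; simp [h1, h2]; omega
      · have := ih1 h3; simp [h1, h2]; omega

theorem reachable_of_good {T : Config} {k : ℕ} (hk : 2 ≤ k) (hkn : k ≤ n) :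
    (Good T k true = true → ∀ i (hi : 2 ≤ i ∧ i ≤ n), i ≤ k →
      (graphOn n (toEdgeSet T)).Reachable (vert hi) (hubVert n)) ∧
    (Good T k false = true → ∀ i (hi : 2 ≤ i ∧ i ≤ n), i ≤ k →
      (graphOn n (toEdgeSet T)).Reachable (vert hi) (hubVert n) ∨
      (graphOn n (toEdgeSet T)).Reachable (vert hi) (vert ⟨hk, hkn⟩)) := by
  induction k, hk using Nat.le_induction with
  | base =>
    constructor
    · intro h i hi hi2
      obtain rfl : i = 2 := by omega
      exact (adj_spoke hi ((good_two.1 h).2 rfl)).symm.reachable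
    · intro h i hi hi2
      obtain rfl : i = 2 := by omega
      exact Or.inr (SimpleGraph.Reachable.refl _)
  | succ k hk ih =>
    obtain ⟨ih1, ih2⟩ := ih (by omega)
    rw [good_succ_true hk, good_succ_false hk]
    have hk1 : 2 ≤ k + 1 ∧ k + 1 ≤ n := ⟨by omega, hkn⟩
    have hk0 : 2 ≤ k ∧ k ≤ n := ⟨hk, by omega⟩
    have hl : link k ∈ T → (graphOn n (toEdgeSet T)).Reachable (vert hk0) (vert hk1) :=
      fun h => (adj_link hk0 hk1 h).reachable
    have hs : spoke (k + 1) ∈ T → (graphOn n (toEdgeSet T)).Reachable (vert hk1) (hubVert n) :=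
      fun h => (adj_spoke hk1 h).symm.reachable
    constructor
    · rintro (⟨h1, h2, h3⟩ | ⟨h1, h2, h3⟩ | ⟨h1, h2, h3⟩) i hi hik
      · rcases Nat.lt_or_ge k i with h | h
        · obtain rfl : i = k + 1 := by omega
          exact hs h1
        · rcases ih2 h3 i hi h with h | h
          · exact h
          · exact (h.trans (hl h2)).trans (hs h1)
      · rcases Nat.lt_or_ge k i with h | h
        · obtain rfl : i = k + 1 := by omega
          exact hs h1
        · exact ih1 h3 i hi h
      · rcases Nat.lt_or_ge k i with h | h
        · obtain rfl : i = k + 1 := by omega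
          exact (hl h2).symm.trans (ih1 h3 k hk0 le_rfl)
        · exact ih1 h3 i hi h
    · rintro ⟨h1, h2⟩ i hi hik
      rcases Nat.lt_or_ge k i with h | h
      · obtain rfl : i = k + 1 := by omega
        exact Or.inr (SimpleGraph.Reachable.refl _)
      · rcases h2 with ⟨h2, h3⟩ | ⟨h2, h3⟩
        · exact (ih2 h3 i hi h).imp_right fun h => h.trans (hl h2)
        · exact Or.inl (ih1 h3 i hi h)

theorem IsTree.isSpanningTree {T : Config} (hn : 2 ≤ n) (h : IsTree n T) :
    IsSpanningTree n (toEdgeSet T) := by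
  refine ⟨?_, ?_⟩
  · rw [← toEdgeSet_edgesUpTo]
    exact Finset.image_subset_image h.sub
  · have : Finite (Vertex n) := Nat.finite_of_card_ne_zero (by rw [card_vertex hn]; omega)
    rw [SimpleGraph.isTree_iff_connected_and_card, card_vertex hn, card_edgeSet h.sub]
    constructor
    · have hr : ∀ v, (graphOn n (toEdgeSet T)).Reachable v (hubVert n) := by
        intro v
        rcases vertex_cases v with rfl | ⟨i, hi, rfl⟩
        · exact SimpleGraph.Reachable.refl _
        · exact (reachable_of_good hn le_rfl).1 h.good i hi hi.2
      have : Nonempty (Vertex n) := ⟨hubVert n⟩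
      exact ⟨fun u v => (hr u).trans (hr v).symm⟩
    · have := (card_of_good hn).1 h.good
      rwa [Finset.inter_eq_right.2 h.sub] at this

/-- A set of consecutive vertices without spokes is joined to the rest of the tree by a link. -/
theorem false_of_isolated {T : Config} (hc : (graphOn n (toEdgeSet T)).Connected) {a b : ℕ}
    (ha : 2 ≤ a) (hab : a ≤ b) (hb : b ≤ n) (hs : ∀ i, a ≤ i → i ≤ b → spoke i ∉ T)
    (hl : link (a - 1) ∉ T) (hr : link b ∉ T) : False := by
  have h := hc.preconnected (vert (n := n) (i := a) (by omega)) (hubVert n)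
  rw [SimpleGraph.reachable_iff_reflTransGen] at h
  have key : ∀ v, Relation.ReflTransGen (graphOn n (toEdgeSet T)).Adj
      (vert (n := n) (i := a) (by omega)) v → ∃ i : ℕ, a ≤ i ∧ i ≤ b ∧ v.1 = i := by
    intro v hv
    induction hv with
    | refl => exact ⟨a, le_rfl, hab, rfl⟩
    | @tail v w _ hvw ih =>
      obtain ⟨i, h1, h2, h3⟩ := ih
      obtain ⟨h4, -⟩ := graphOn_adj.1 hvw
      rw [h3] at h4
      obtain ⟨e, he, heq⟩ := Finset.mem_image.1 h4
      cases e with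
      | spoke j =>
        simp only [Edge.toSym, Sym2.eq_iff, ENat.top_ne_natCast, false_and, false_or,
          Nat.cast_inj] at heq
        exact absurd (heq.2 ▸ he) (hs i h1 h2)
      | link j =>
        simp only [Edge.toSym, Sym2.eq_iff, Nat.cast_inj] at heq
        rcases heq with ⟨rfl, h5⟩ | ⟨h5, h6⟩
        · refine ⟨j + 1, by omega, ?_, h5.symm⟩
          rcases h2.eq_or_lt with rfl | h2
          · exact absurd he hr
          · exact h2
        · refine ⟨j, ?_, by omega, h5.symm⟩
          by_contra hja
          have : j = a - 1 := by omega
          exact hl (this ▸ he)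
  obtain ⟨i, -, -, h⟩ := key _ h
  exact ENat.top_ne_natCast i h

/-- Two spokes at the same run of links close a cycle. -/
theorem false_of_two_spokes {T : Config} (hc : (graphOn n (toEdgeSet T)).IsAcyclic) {a b : ℕ}
    (ha : 2 ≤ a) (hab : a < b) (hb : b ≤ n) (hl : ∀ i, a ≤ i → i < b → link i ∈ T)
    (hsa : spoke a ∈ T) (hsb : spoke b ∈ T) : False := by
  have hA : 2 ≤ a ∧ a ≤ n := by omega
  have hadj := adj_spoke hA hsa
  have hbr := SimpleGraph.isAcyclic_iff_forall_adj_isBridge.1 hc hadj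
  rw [SimpleGraph.isBridge_iff] at hbr
  apply hbr
  have hne : ∀ {i} (hi : 2 ≤ i ∧ i ≤ n), hubVert n ≠ vert hi := fun {i} hi h =>
    ENat.top_ne_natCast i (congrArg Subtype.val h)
  have hvne : ∀ {i j} (hi : 2 ≤ i ∧ i ≤ n) (hj : 2 ≤ j ∧ j ≤ n), i ≠ j → vert hi ≠ vert hj :=
    fun {i j} hi hj hij h => hij (Nat.cast_injective (R := ℕ∞) (congrArg Subtype.val h))
  have hpath : ∀ i (hi : 2 ≤ i ∧ i ≤ n), a ≤ i → i ≤ b →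
      ((graphOn n (toEdgeSet T)).deleteEdges {s(hubVert n, vert hA)}).Reachable
        (vert hA) (vert hi) := by
    intro i hi hai
    induction i, hai using Nat.le_induction with
    | base => exact fun _ => SimpleGraph.Reachable.refl _
    | succ i hai ih =>
      intro hib
      have hi' : 2 ≤ i ∧ i ≤ n := by omega
      refine (ih hi' (by omega)).trans (SimpleGraph.Adj.reachable ?_)
      rw [SimpleGraph.deleteEdges_adj]
      refine ⟨adj_link hi' hi (hl i hai (by omega)), ?_⟩
      simp [(hne hi).symm, (hne hi').symm]
  have hB : 2 ≤ b ∧ b ≤ n := by omega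
  refine SimpleGraph.Reachable.trans (SimpleGraph.Adj.reachable ?_) (hpath b hB hab.le le_rfl).symm
  rw [SimpleGraph.deleteEdges_adj]
  refine ⟨adj_spoke hB hsb, ?_⟩
  simp [hvne hB hA hab.ne', (hne hA)]

/-- The scan carries a witness: in state `true` a spoke joined to $v_k$ by links, in state `false` a
spokeless interval ending at $v_k$ and cut off on its left. A failure of the scan then produces a
cycle or a part separated from the hub. -/
theorem isTree_of_isSpanningTree {T : Config} (hn : 2 ≤ n) (hT : T ⊆ edgesUpTo n)
    (h : IsSpanningTree n (toEdgeSet T)) : IsTree n T := by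
  obtain ⟨-, hc, ha⟩ := h
  have hl1 : link 1 ∉ T := fun h => by have := hT h; simp at this
  have hln : link n ∉ T := fun h => by have := hT h; simp at this
  suffices key : ∀ k, 2 ≤ k → k ≤ n →
      (Good T k true = true ∧ ∃ i, 2 ≤ i ∧ i ≤ k ∧ spoke i ∈ T ∧ ∀ j, i ≤ j → j < k → link j ∈ T) ∨
      (Good T k false = true ∧ ∃ a, 2 ≤ a ∧ a ≤ k ∧ link (a - 1) ∉ T ∧
        ∀ j, a ≤ j → j ≤ k → spoke j ∉ T) by
    rcases key n hn le_rfl with h | ⟨-, a, h1, h2, h3, h4⟩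
    · exact ⟨hT, h.1⟩
    · exact (false_of_isolated hc h1 h2 le_rfl h4 h3 hln).elim
  intro k hk
  induction k, hk using Nat.le_induction with
  | base =>
    intro _
    by_cases hs : spoke 2 ∈ T
    · exact Or.inl ⟨by simp [good_two, hs], 2, le_rfl, le_rfl, hs, by omega⟩
    · refine Or.inr ⟨by simp [good_two, hs], 2, le_rfl, le_rfl, hl1, fun j h1 h2 => ?_⟩
      obtain rfl : j = 2 := by omega
      exact hs
  | succ k hk ih =>
    intro hkn
    rw [good_succ_true hk, good_succ_false hk]
    rcases ih (by omega) with ⟨hg, i, h1, h2, h3, h4⟩ | ⟨hg, a, h1, h2, h3, h4⟩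
    · by_cases hl : link k ∈ T
      · have h5 : ∀ j, i ≤ j → j < k + 1 → link j ∈ T := fun j hj hjk => by
          rcases Nat.lt_succ_iff_lt_or_eq.1 hjk with h | rfl
          · exact h4 j hj h
          · exact hl
        by_cases hs : spoke (k + 1) ∈ T
        · exact (false_of_two_spokes ha h1 (by omega) hkn h5 h3 hs).elim
        · exact Or.inl ⟨by simp [hl, hs, hg], i, h1, by omega, h3, h5⟩
      · by_cases hs : spoke (k + 1) ∈ T
        · exact Or.inl ⟨by simp [hl, hs, hg], k + 1, by omega, le_rfl, hs, by omega⟩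
        · refine Or.inr ⟨by simp [hl, hs, hg], k + 1, by omega, le_rfl, hl, fun j h5 h6 => ?_⟩
          obtain rfl : j = k + 1 := by omega
          exact hs
    · by_cases hl : link k ∈ T
      · by_cases hs : spoke (k + 1) ∈ T
        · exact Or.inl ⟨by simp [hl, hs, hg], k + 1, by omega, le_rfl, hs, by omega⟩
        · refine Or.inr ⟨by simp [hl, hs, hg], a, h1, by omega, h3, fun j h5 h6 => ?_⟩
          rcases Nat.le_succ_iff.1 h6 with h | rfl
          · exact h4 j h5 h
          · exact hs
      · exact (false_of_isolated hc h1 h2 (by omega) h4 h3 hl).elim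

theorem isSpanningTree_iff (hn : 2 ≤ n) {E : EdgeSet} :
    IsSpanningTree n E ↔ ∃ T, IsTree n T ∧ toEdgeSet T = E := by
  constructor
  · intro h
    have hsub := h.1
    rw [← toEdgeSet_edgesUpTo] at hsub
    obtain ⟨T, hT, rfl⟩ := Finset.subset_image_iff.1 hsub
    exact ⟨T, isTree_of_isSpanningTree hn hT h, rfl⟩
  · rintro ⟨T, hT, rfl⟩
    exact hT.isSpanningTree hn

end Graph

/-! ### Steps as moves, and the greedy choice -/

/-- The neighbour of `v_u` in a given direction. -/
def neighbor (u : ℕ) : Dir → Label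
  | left => ((u - 1 : ℕ) : Label)
  | right => ((u + 1 : ℕ) : Label)
  | hub => ⊤

def Step.toMove (m : Step) : Move :=
  ⟨(m.pivot : Label), neighbor m.pivot m.removed, neighbor m.pivot m.added⟩

theorem toSym_incident {u : ℕ} (hu : 2 ≤ u) (d : Dir) :
    (incident u d).toSym = s((u : Label), neighbor u d) := by
  cases d with
  | left =>
    simp only [incident, Edge.toSym, neighbor]
    rw [Nat.sub_add_cancel (by omega), Sym2.eq_swap]
  | right => rfl
  | hub => exact Sym2.eq_swap

theorem exists_of_toSym_eq {u : ℕ} {x : Label} {e : Edge}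
    (h : e.toSym = s((u : Label), x)) : ∃ d, neighbor u d = x := by
  cases e with
  | spoke j =>
    simp only [Edge.toSym, Sym2.eq_iff, ENat.top_ne_natCast, false_and, false_or] at h
    exact ⟨hub, h.1⟩
  | link j =>
    simp only [Edge.toSym, Sym2.eq_iff, Nat.cast_inj] at h
    rcases h with ⟨rfl, h⟩ | ⟨h, rfl⟩
    · exact ⟨right, h⟩
    · exact ⟨left, h⟩

/-- Left, right, hub is the label order $u-1<u+1<\infty$, so `Step.Before` agrees with the priority
of moves. -/
theorem neighbor_lt_iff {u : ℕ} {d d' : Dir} :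
    neighbor u d < neighbor u d' ↔ d.rank < d'.rank := by
  have h1 : ((u - 1 : ℕ) : Label) < ((u + 1 : ℕ) : Label) := by
    rw [Nat.cast_lt]; omega
  have h2 := ENat.natCast_lt_top (u - 1)
  have h3 := ENat.natCast_lt_top (u + 1)
  cases d <;> cases d' <;> simp only [neighbor, Dir.rank] <;>
    simp only [h1, h2, h3, h1.not_gt, lt_irrefl, not_top_lt] <;> decide

theorem neighbor_injective (u : ℕ) : Function.Injective (neighbor u) := by
  intro d d' h
  have h1 := (neighbor_lt_iff (u := u) (d := d) (d' := d')).not.1 (by rw [h]; exact lt_irrefl _)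
  have h2 := (neighbor_lt_iff (u := u) (d := d') (d' := d)).not.1 (by rw [h]; exact lt_irrefl _)
  cases d <;> cases d' <;> simp_all [Dir.rank]

theorem Step.IsPivot.pivot_mem {k : ℕ} {T : Config} {m : Step} (h : m.IsPivot k T)
    (hT : T ⊆ edgesUpTo k) : 2 ≤ m.pivot ∧ m.pivot ≤ k := by
  obtain ⟨p, r, a⟩ := m
  obtain ⟨h1, h2, h3⟩ := h
  have h4 := hT h1
  cases r <;> cases a <;> simp_all [Step.old, Step.new] <;> omega

theorem toMove_apply {m : Step} {T : Config} (hm : 2 ≤ m.pivot) :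
    m.toMove.apply (toEdgeSet T) = toEdgeSet (m.apply T) := by
  have h := fun d => toSym_incident hm d
  rw [Move.apply, Step.apply, toEdgeSet, toEdgeSet, Finset.image_insert,
    Finset.image_erase toSym_injective]
  rw [Step.new, Step.old, h, h]
  rfl

theorem toMove_isPivotMove {n : ℕ} {m : Step} {T : Config} (hm : 2 ≤ m.pivot) :
    m.toMove.IsPivotMove n (toEdgeSet T) ↔ m.IsPivot n T := by
  have h := fun d => toSym_incident hm d
  simp only [Move.IsPivotMove, Step.toMove, Step.IsPivot, Step.old, Step.new, ← h,
    ← toEdgeSet_edgesUpTo, mem_toEdgeSet]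

theorem toMove_inv (m : Step) : m.toMove.inv = m.inv.toMove := rfl

theorem revMoves_map_toMove (l : List Step) :
    revMoves (l.map Step.toMove) = (revSteps l).map Step.toMove := by
  simp [revMoves, revSteps, Function.comp_def, toMove_inv]

/-- From size 3 on, `varEdge` affects only the connecting move, so `tour` needs no such parameter.
-/
theorem gen_true_true (k : ℕ) : gen (k + 3) true true =
    gen (k + 2) true false ++ ⟨(k + 3 : ℕ), (k + 2 : ℕ), (k + 4 : ℕ)⟩ :: gen (k + 3) false false := by
  cases k with
  | zero => simp [gen]
  | succ k =>
    simp only [gen, List.append_assoc, Nat.add_assoc]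
    simp

theorem gen_eq (k : ℕ) (s : Bool) : gen k s false = (tour k s).map Step.toMove := by
  induction k using Nat.strong_induction_on generalizing s with
  | _ k ih =>
    match k with
    | 0 => simp [gen, tour]
    | 1 => simp [gen, tour]
    | 2 => simp [gen, tour]
    | 3 => cases s <;> simp [gen, tour, Step.toMove, neighbor]
    | 4 =>
      simp only [gen, tour]
      cases s <;> simp [ revMoves, Move.inv, Step.toMove, neighbor, revSteps, Step.inv]
    | k + 5 =>
      have h4 := ih (k + 4) (by omega)
      have h3 := ih (k + 3) (by omega)
      have h2 := ih (k + 2) (by omega)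
      have hg : gen (k + 5) s false = (if s then
          gen (k + 4) true false ++ [⟨(k + 5 : ℕ), (k + 4 : ℕ), ⊤⟩] else []) ++
          revMoves (gen (k + 4) true false) ++ [⟨(k + 4 : ℕ), (k + 3 : ℕ), (k + 5 : ℕ)⟩] ++
          gen (k + 3) true true ++ [⟨(k + 3 : ℕ), (k + 4 : ℕ), ⊤⟩] ++
          revMoves (gen (k + 3) false false) := by
        rw [gen, if_pos (show k + 1 + 4 > 4 by omega)]
        rfl
      rw [hg, gen_true_true, h4, h3, h2, revMoves_map_toMove, revMoves_map_toMove]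
      have e₁ : (k : Label) + 5 = k + 4 + 1 := by ring
      have e₂ : (k : Label) + 4 = k + 3 + 1 := by ring
      cases s <;> simp [tour, Step.toMove, neighbor, e₁, e₂]

/-- The order in which the greedy rule considers the moves. -/
def Move.Before (m' m : Move) : Prop :=
  m'.pivot < m.pivot ∨ m'.pivot = m.pivot ∧
    (m'.removed < m.removed ∨ m'.removed = m.removed ∧ m'.added < m.added)

theorem mem_movesByPriority {n : ℕ} {m : Move} : m ∈ movesByPriority n ↔
    m.pivot ∈ vertexList n ∧ m.removed ∈ vertexList n ∧ m.added ∈ vertexList n := by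
  simp only [movesByPriority, List.mem_flatMap, List.mem_map]
  constructor
  · rintro ⟨u, hu, v, hv, w, hw, rfl⟩
    exact ⟨hu, hv, hw⟩
  · rintro ⟨hu, hv, hw⟩
    exact ⟨_, hu, _, hv, _, hw, rfl⟩

theorem movesByPriority_pairwise (n : ℕ) : (movesByPriority n).Pairwise Move.Before := by
  have h := vertexList_pairwise n
  rw [movesByPriority, List.pairwise_flatMap]
  refine ⟨fun u _ => ?_, h.imp fun {u u'} huu m hm m' hm' => ?_⟩
  · rw [List.pairwise_flatMap]
    refine ⟨fun v _ => ?_, h.imp fun {v v'} hvv m hm m' hm' => ?_⟩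
    · rw [List.pairwise_map]
      exact h.imp fun hw => Or.inr ⟨rfl, Or.inr ⟨rfl, hw⟩⟩
    · obtain ⟨w, -, rfl⟩ := List.mem_map.1 hm
      obtain ⟨w', -, rfl⟩ := List.mem_map.1 hm'
      exact Or.inr ⟨rfl, Or.inl hvv⟩
  · simp only [List.mem_flatMap, List.mem_map] at hm hm'
    obtain ⟨v, -, w, -, rfl⟩ := hm
    obtain ⟨v', -, w', -, rfl⟩ := hm'
    exact Or.inl huu

theorem find?_eq_some_of_pairwise {α : Type*} {r : α → α → Prop} {p : α → Bool} {l : List α}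
    {a : α} (hl : l.Pairwise r) (ha : a ∈ l) (hp : p a = true)
    (h : ∀ b ∈ l, r b a → p b ≠ true) : l.find? p = some a := by
  induction l with
  | nil => simp at ha
  | cons b l ih =>
    rw [List.pairwise_cons] at hl
    rcases List.mem_cons.1 ha with rfl | ha
    · simp [hp]
    · have hb : p b = false := by simpa using h b List.mem_cons_self (hl.1 a ha)
      rw [List.find?_cons, hb]
      exact ih hl.2 ha fun c hc => h c (List.mem_cons_of_mem _ hc)

theorem neighbor_mem_vertexList {n u : ℕ} {d : Dir} (hu : 2 ≤ u)
    (h : incident u d ∈ edgesUpTo n) : neighbor u d ∈ vertexList n := by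
  rw [mem_vertexList]
  cases d with
  | left => exact Or.inr ⟨_, by simp at h; omega, rfl⟩
  | right => exact Or.inr ⟨_, by simp at h; omega, rfl⟩
  | hub => exact Or.inl rfl

theorem greedyMove?_eq {n : ℕ} (hn : 2 ≤ n) {V : Finset Config} {T : Config} {m : Step}
    (hT : IsTree n T) (hm : m.IsPivot n T) (ht : IsTree n (m.apply T)) (hV : m.apply T ∉ V)
    (hb : NoneBefore n V T m) :
    greedyMove? n (V.image toEdgeSet) (toEdgeSet T) = some m.toMove := by
  classical
  obtain ⟨hp, hp'⟩ := hm.pivot_mem hT.sub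
  refine find?_eq_some_of_pairwise (movesByPriority_pairwise n) ?_ ?_ ?_
  · rw [mem_movesByPriority]
    exact ⟨mem_vertexList.2 (Or.inr ⟨_, ⟨hp, hp'⟩, rfl⟩),
      neighbor_mem_vertexList hp (hT.sub hm.1), neighbor_mem_vertexList hp hm.2.1⟩
  · simp only [decide_eq_true_eq, Move.Valid, toMove_apply hp]
    refine ⟨(toMove_isPivotMove hp).2 hm, ht.isSpanningTree hn, ?_⟩
    rwa [toEdgeSet_injective.mem_finset_image]
  · intro a ha hab
    simp only [decide_eq_true_eq, ne_eq]
    rintro ⟨hpa, hta, hVa⟩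
    obtain ⟨hu, -, -⟩ := mem_movesByPriority.1 ha
    have hle : a.pivot ≤ (m.pivot : Label) := by
      rcases hab with h | h
      · exact h.le
      · exact h.1.le
    obtain ⟨u, v, w⟩ := a
    -- A move with pivot $v_\infty$ cannot precede `m`, whose pivot is finite.
    rcases mem_vertexList.1 hu with h | ⟨u, hu2, rfl⟩
    · simp only at h hle
      rw [h] at hle
      exact absurd (lt_of_le_of_lt hle (ENat.natCast_lt_top _)) (lt_irrefl _)
    · obtain ⟨e, -, he⟩ := Finset.mem_image.1 hpa.1
      obtain ⟨d, rfl⟩ := exists_of_toSym_eq he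
      have hf := hpa.2.1
      rw [← toEdgeSet_edgesUpTo] at hf
      obtain ⟨f, -, hf⟩ := Finset.mem_image.1 hf
      obtain ⟨d', rfl⟩ := exists_of_toSym_eq hf
      have hmv : (⟨(u : Label), neighbor u d, neighbor u d'⟩ : Move) =
        (⟨u, d, d'⟩ : Step).toMove := rfl
      rw [hmv] at hpa hta hVa hab
      rw [toMove_isPivotMove hu2.1] at hpa
      rw [toMove_apply hu2.1] at hta hVa
      rw [toEdgeSet_injective.mem_finset_image] at hVa
      have hsub := Step.apply_sub hT.sub hpa.2.1
      refine hVa (noneBefore_iff.1 hb _ ?_ hpa (isTree_of_isSpanningTree hn hsub hta))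
      simp only [Move.Before, Step.toMove, Nat.cast_lt, Nat.cast_inj] at hab
      rcases hab with h | ⟨rfl, h⟩
      · exact Or.inl h
      · refine Or.inr ⟨rfl, ?_⟩
        simpa only [neighbor_lt_iff, (neighbor_injective m.pivot).eq_iff] using h

/-- This covers moves with pivot $v_\infty$ too: any valid move would have to produce an unlisted
tree. -/
theorem greedyMove?_eq_none {n : ℕ} (hn : 2 ≤ n) {V : Finset Config} {E : EdgeSet}
    (hV : ∀ X, IsTree n X → X ∈ V) : greedyMove? n (V.image toEdgeSet) E = none := by
  classical
  rw [greedyMove?, List.find?_eq_none]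
  intro m _
  simp only [decide_eq_true_eq]
  rintro ⟨-, ht, hnot⟩
  obtain ⟨X, hX, hXE⟩ := (isSpanningTree_iff hn).1 ht
  exact hnot (hXE ▸ Finset.mem_image_of_mem _ (hV X hX))

theorem greedyFrom_of_none {n : ℕ} {V : Finset EdgeSet} {E : EdgeSet}
    (h : greedyMove? n V E = none) : greedyFrom n V E = [] := by
  rw [greedyFrom]
  split
  · rfl
  · rename_i m hm
    rw [h] at hm
    cases hm

theorem greedyFrom_of_some {n : ℕ} {V : Finset EdgeSet} {E : EdgeSet} {m : Move}
    (h : greedyMove? n V E = some m) :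
    greedyFrom n V E = m.apply E :: greedyFrom n (insert (m.apply E) V) (m.apply E) := by
  rw [greedyFrom]
  split
  · rename_i hm
    rw [h] at hm
    cases hm
  · rename_i m' hm
    rw [h] at hm
    cases hm
    rfl

/-! ### Conclusions for the two listings -/

namespace GreedyRun

variable {n : ℕ} {V : Finset Config} {T : Config} {ms : List Step}

/-- A greedy run is only known to be an initial part of the greedy listing; exhaustiveness makes the
rule stop where the run does. -/
theorem greedyFrom_eq (hn : 2 ≤ n) (hT : IsTree n T) (h : GreedyRun n V T ms)
    (hall : ∀ X, IsTree n X → X ∈ V ∨ X ∈ (trees T ms).tail) :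
    greedyFrom n (V.image toEdgeSet) (toEdgeSet T) = (trees T ms).tail.map toEdgeSet := by
  induction ms generalizing V T with
  | nil => exact greedyFrom_of_none (greedyMove?_eq_none hn fun X hX => by simpa using hall X hX)
  | cons m ms ih =>
    obtain ⟨⟨h1, h2, h3, h4⟩, h⟩ := h
    rw [greedyFrom_of_some (greedyMove?_eq hn hT h1 h2 h3 h4),
      toMove_apply (h1.pivot_mem hT.sub).1, ← Finset.image_insert, ih h2 h]
    · cases ms <;> simp
    · intro X hX
      have := hall X hX
      cases ms <;> simp at this ⊢ <;> tauto

theorem scanl_eq (hT : IsTree n T) (h : GreedyRun n V T ms) :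
    (ms.map Step.toMove).scanl (fun T m => m.apply T) (toEdgeSet T) =
      (trees T ms).map toEdgeSet := by
  induction ms generalizing V T with
  | nil => simp
  | cons m ms ih =>
    rw [List.map_cons, List.scanl_cons, toMove_apply (h.1.1.pivot_mem hT.sub).1, ih h.1.2.1 h.2]
    simp

theorem nodup (hT : T ∈ V) (h : GreedyRun n V T ms) :
    (trees T ms).Nodup ∧ ∀ X ∈ (trees T ms).tail, X ∉ V := by
  induction ms generalizing V T with
  | nil => simp
  | cons m ms ih =>
    obtain ⟨h1, h2⟩ := ih (Finset.mem_insert_self _ _) h.2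
    have key : ∀ X ∈ trees (m.apply T) ms, X ∉ V := by
      intro X hX
      have : X = m.apply T ∨ X ∈ (trees (m.apply T) ms).tail := by
        cases ms <;> simpa using hX
      rcases this with rfl | h'
      · exact h.1.2.2.1
      · exact fun hXV => h2 X h' (Finset.mem_insert_of_mem hXV)
    simp only [trees_cons, List.nodup_cons, List.tail_cons]
    exact ⟨⟨fun hmem => key T hmem hT, h1⟩, key⟩

theorem isChain (hT : IsTree n T) (h : GreedyRun n V T ms) :
    ((trees T ms).map toEdgeSet).IsChain PivotAdj := by
  induction ms generalizing V T with
  | nil => simp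
  | cons m ms ih =>
    have ih' := ih h.1.2.1 h.2
    have hp := (h.1.1.pivot_mem hT.sub).1
    have hm := (toMove_isPivotMove hp).2 h.1.1
    have hadj : PivotAdj (toEdgeSet T) (toEdgeSet (m.apply T)) :=
      ⟨m.toMove, hm.1, hm.2.2, (toMove_apply hp).symm⟩
    cases ms with
    | nil => simpa using hadj
    | cons a l =>
      simp only [trees_cons, List.map_cons] at ih' ⊢
      exact List.IsChain.cons_cons hadj ih'

end GreedyRun

end FanTrees

theorem theorem1 (n : ℕ) (hn : 2 ≤ n) :
    FanTrees.genList n = FanTrees.greedy n (FanTrees.pathTree n) ∧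
      FanTrees.IsPivotGrayCode n (FanTrees.greedy n (FanTrees.pathTree n)) := by
  open FanTrees in
  have hF := fullSpec hn
  have hT := hF.isTree_path
  have hcons : trees (pathConfig n) (tour n true) =
      pathConfig n :: (trees (pathConfig n) (tour n true)).tail := by
    cases tour n true <;> simp
  have hgreedy : greedy n (pathTree n) =
      (trees (pathConfig n) (tour n true)).map toEdgeSet := by
    have h := hF.forward.greedyFrom_eq hn hT fun X hX => by
      have := (hF.mem_trees X).2 hX
      rw [hcons] at this
      simpa using this
    rw [Finset.image_singleton, toEdgeSet_pathConfig] at h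
    rw [greedy, h, hcons, List.map_cons, toEdgeSet_pathConfig, List.tail_cons]
  have hgen : genList n = (trees (pathConfig n) (tour n true)).map toEdgeSet := by
    rw [genList, gen_eq, ← toEdgeSet_pathConfig]
    exact hF.forward.scanl_eq hT
  refine ⟨hgen.trans hgreedy.symm, ?_⟩
  rw [hgreedy]
  refine ⟨?_, fun E => ?_, hF.forward.isChain hT⟩
  · exact (hF.forward.nodup (Finset.mem_singleton_self _)).1.map toEdgeSet_injective
  · rw [isSpanningTree_iff hn, List.mem_map]
    simp only [hF.mem_trees]
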